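/- Let $G$ be a real Lie group which is the semidirect product $G=U\rtimes A$ of closed subgroups $U$ (normal) and $A$, where $U$ and $A$ are contractible, $A$ is abelian, and $U$ is real unipotent, i.e. isomorphic as a topological group to a closed group of real upper triangular $n\times n$ matrices with all diagonal entries equal to $1$ (for some $n$). Equip $G$ with any left-invariant Riemannian metric and the associated distance. Assume that $G$ is tame: there are an element $a\in A$ and a compact set $\Omega\subset U$ (a vacuum subset for $a$) such that for every compact $K\subset U$ there is an integer $n>0$ with $\mathrm{Ad}(a)^nK\subset\Omega$, where $\mathrm{Ad}(a)x=a^{-1}xa$. Then $G$ is Lipschitz 1-connected: there is a constant $C$ such that for every Lipschitz loop $\gamma:S^1\to G$, $$\inf\{\mathrm{Lip}(f)\;:\;f:D^2\to G,\ f|_{S^1}=\gamma\}\le C\,\mathrm{Lip}(\gamma),$$ where $S^1\subset D^2\subset\mathbb{C}$ are the unit circle and the closed unit disk with the Euclidean metric, and $\mathrm{Lip}$ denotes the optimal Lipschitz constant ($\infty$ for a map that is not Lipschitz). -/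

import Mathlib

open scoped Manifold ContDiff NNReal ENNReal Topology Bundle

noncomputable section

/-- The optimal Lipschitz constant `Lip(f)`, equal to `∞` if `f` is not Lipschitz. -/
def lipConst {X Y : Type*} [PseudoEMetricSpace X] [PseudoEMetricSpace Y] (f : X → Y) : ℝ≥0∞ :=
  ⨅ (K : ℝ≥0) (_ : LipschitzWith K f), (K : ℝ≥0∞)

/-- `f : D² → X` restricts to `γ` on `S¹ = ∂D²`. -/
def IsFilling {X : Type*} (γ : Metric.sphere (0 : ℂ) 1 → X)
    (f : Metric.closedBall (0 : ℂ) 1 → X) : Prop :=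
  ∀ z : Metric.sphere (0 : ℂ) 1, f ⟨z, Metric.sphere_subset_closedBall z.2⟩ = γ z

/-- The filling span of a loop: the infimum of `Lip(f)` over all fillings `f` of `γ`. -/
def fillingSpan {X : Type*} [PseudoEMetricSpace X] (γ : Metric.sphere (0 : ℂ) 1 → X) : ℝ≥0∞ :=
  ⨅ (f : Metric.closedBall (0 : ℂ) 1 → X) (_ : IsFilling γ f), lipConst f

/-- `X` is Lipschitz 1-connected: the filling span of every Lipschitz loop is at most a constant
times its Lipschitz constant. -/
def LipschitzOneConnected (X : Type*) [PseudoEMetricSpace X] : Prop :=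
  ∃ C : ℝ≥0, ∀ γ : Metric.sphere (0 : ℂ) 1 → X, (∃ K : ℝ≥0, LipschitzWith K γ) →
    fillingSpan γ ≤ C * lipConst γ

/-- A topological group is real unipotent if it is isomorphic, as a topological group, to a closed
group of real upper triangular matrices with all diagonal entries equal to `1`. -/
def IsRealUnipotent (U : Type*) [Group U] [TopologicalSpace U] : Prop :=
  ∃ (n : ℕ) (ρ : U →* Matrix (Fin n) (Fin n) ℝ), Topology.IsClosedEmbedding ρ ∧
    ∀ u, (ρ u).IsUpperTriangular ∧ ∀ i, ρ u i i = 1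

/-- The topological group `G` is the (internal) semidirect product `U ⋊ A` of its closed subgroups
`U` and `A`, where `U` is normal, real unipotent and contractible, and `A` is abelian and
contractible. -/
structure IsUnipotentByAbelian {G : Type*} [Group G] [TopologicalSpace G]
    (U A : Subgroup G) : Prop where
  isClosed_left : IsClosed (U : Set G)
  isClosed_right : IsClosed (A : Set G)
  normal : U.Normal
  isComplement : U.IsComplement' A
  unipotent : IsRealUnipotent U
  comm : IsMulCommutative A
  contractible_left : ContractibleSpace U
  contractible_right : ContractibleSpace A

/-- `Ω` is a vacuum subset of `U` for `a`: `Ω ⊆ U` is compact, and every compact `K ⊆ U` is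
mapped into `Ω` by some positive power of the conjugation `Ad(a) : x ↦ a⁻¹ x a`. -/
def IsVacuumSubset {G : Type*} [Group G] [TopologicalSpace G] (U : Subgroup G) (a : G)
    (Ω : Set G) : Prop :=
  IsCompact Ω ∧ Ω ⊆ U ∧ ∀ K : Set G, IsCompact K → K ⊆ U →
    ∃ n : ℕ, 0 < n ∧ (fun x ↦ a⁻¹ * x * a)^[n] '' K ⊆ Ω

/-- `U ⋊ A` is tame: some element of `A` has a vacuum subset. -/
def IsTame {G : Type*} [Group G] [TopologicalSpace G] (U A : Subgroup G) : Prop :=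
  ∃ a ∈ A, ∃ Ω : Set G, IsVacuumSubset U a Ω

/-- The Riemannian metric on the Lie group `G` is left invariant: the differentials of all left
translations are isometries between tangent spaces. -/
def IsLeftInvariantMetric (E : Type*) [NormedAddCommGroup E] [NormedSpace ℝ E]
    (G : Type*) [Group G] [TopologicalSpace G] [ChartedSpace E G]
    [Bundle.RiemannianBundle (fun x : G ↦ TangentSpace 𝓘(ℝ, E) x)] : Prop :=
  ∀ (g x : G) (v : TangentSpace 𝓘(ℝ, E) x),
    ‖mfderiv 𝓘(ℝ, E) 𝓘(ℝ, E) (fun y : G ↦ g * y) x v‖ = ‖v‖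

end

open Manifold Set Filter

/-!
A left-invariant Riemannian distance is a length metric, and near the identity its commutators are
quadratically small and its powers grow linearly until they leave a fixed ball (it is a *Gleason
metric*). For the abelian group `A` this makes the exponential map of one-parameter subgroups an
open covering, hence a bijection as `A` is contractible, so that every element of `G` is
`e (ℓ g) * u` with `u ∈ U`, where `e` and `ℓ` are Lipschitz and `ℓ g` is a vector.

A unipotent matrix whose powers stay bounded is trivial, so the vacuum subset can be improved: some
power of `Ad(a)` halves the norm of the elements of `U` near the identity. The flow
`s ↦ Ad(e (s • a))` thus contracts `U` exponentially near the identity. Cutting a long path into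
short pieces, one sees that for `s ≥ 0` this flow is uniformly Lipschitz on `G`, and that it brings
`u ∈ U` close to the identity within a time linear in `‖u‖`.

Let `β` be a `K`-Lipschitz loop through the identity. Multiplying it on the right by `e (s • a)`,
for `s` from `0` to a multiple of `K`, moves it through `O(K)`-Lipschitz loops to a left translate
of a loop `e (α z) * v z` with `v` close to the identity in `U`. This last loop is coned off at
radius `r` by `e (r • α z)` times the flow of `v z` at time `-log r`: the exponential contraction
makes the second factor Lipschitz in `r`.
-/

section RiemannianDistance

variable {E : Type*} [NormedAddCommGroup E] [NormedSpace ℝ E]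

theorem riemannianEDist_mul_left_le {G : Type*} [Group G] [TopologicalSpace G] [ChartedSpace E G]
    [LieGroup 𝓘(ℝ, E) ∞ G] [Bundle.RiemannianBundle (fun x : G ↦ TangentSpace 𝓘(ℝ, E) x)]
    (hG : IsLeftInvariantMetric E G) (g x y : G) :
    riemannianEDist 𝓘(ℝ, E) (g * x) (g * y) ≤ riemannianEDist 𝓘(ℝ, E) x y := by
  have hmul : ContMDiff 𝓘(ℝ, E) 𝓘(ℝ, E) ∞ (fun z : G ↦ g * z) := contMDiff_mul_left
  refine le_of_forall_gt fun r hr ↦ ?_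
  obtain ⟨γ, h0, h1, hγ, hlen⟩ := exists_lt_of_riemannianEDist_lt hr
  refine lt_of_le_of_lt ?_ hlen
  refine (riemannianEDist_le_pathELength (γ := fun t ↦ g * γ t) (a := 0) (b := 1)
    ((hmul.of_le (by simp)).comp_contMDiffOn hγ) (by simp [h0]) (by simp [h1])
    zero_le_one).trans_eq ?_
  rw [pathELength_eq_lintegral_mfderivWithin_Icc, pathELength_eq_lintegral_mfderivWithin_Icc]
  refine MeasureTheory.setLIntegral_congr_fun measurableSet_Icc fun t ht ↦ ?_
  have hchain : mfderivWithin 𝓘(ℝ, ℝ) 𝓘(ℝ, E) ((fun z : G ↦ g * z) ∘ γ) (Icc 0 1) t =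
      (mfderiv 𝓘(ℝ, E) 𝓘(ℝ, E) (fun z : G ↦ g * z) (γ t)) ∘L
        (mfderivWithin 𝓘(ℝ, ℝ) 𝓘(ℝ, E) γ (Icc 0 1) t) := by
    apply mfderiv_comp_mfderivWithin
    · exact hmul.mdifferentiableAt (by simp)
    · exact hγ.mdifferentiableOn one_ne_zero t ht
    · rw [uniqueMDiffWithinAt_iff_uniqueDiffWithinAt]
      exact uniqueDiffOn_Icc zero_lt_one t ht
  have hchain_one : mfderivWithin 𝓘(ℝ, ℝ) 𝓘(ℝ, E) (fun t ↦ g * γ t) (Icc 0 1) t 1 =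
      (mfderiv 𝓘(ℝ, E) 𝓘(ℝ, E) (fun z : G ↦ g * z) (γ t))
        (mfderivWithin 𝓘(ℝ, ℝ) 𝓘(ℝ, E) γ (Icc 0 1) t 1) := DFunLike.congr_fun hchain 1
  simp only [hchain_one]
  rw [← ofReal_norm, ← ofReal_norm, hG g (γ t)]

theorem isIsometricSMul_of_isLeftInvariantMetric {G : Type*} [Group G] [PseudoEMetricSpace G]
    [ChartedSpace E G] [LieGroup 𝓘(ℝ, E) ∞ G]
    [Bundle.RiemannianBundle (fun x : G ↦ TangentSpace 𝓘(ℝ, E) x)]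
    [IsRiemannianManifold 𝓘(ℝ, E) G] (hG : IsLeftInvariantMetric E G) :
    IsIsometricSMul G G := by
  refine ⟨fun g x y ↦ ?_⟩
  rw [IsRiemannianManifold.out (I := 𝓘(ℝ, E)), IsRiemannianManifold.out (I := 𝓘(ℝ, E))]
  refine le_antisymm (riemannianEDist_mul_left_le hG g x y) ?_
  simpa using riemannianEDist_mul_left_le hG g⁻¹ (g * x) (g * y)

theorem exists_dist_lt_dist_lt_of_isRiemannianManifold {M : Type*} [PseudoMetricSpace M]
    [ChartedSpace E M] [Bundle.RiemannianBundle (fun x : M ↦ TangentSpace 𝓘(ℝ, E) x)]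
    [IsRiemannianManifold 𝓘(ℝ, E) M] {x y : M} {r s : ℝ} (hr : 0 < r) (hs : 0 < s)
    (h : dist x y < r + s) : ∃ z, dist x z < r ∧ dist z y < s := by
  have hlt : riemannianEDist 𝓘(ℝ, E) x y < ENNReal.ofReal (r + s) := by
    rw [← IsRiemannianManifold.out (I := 𝓘(ℝ, E)), edist_dist]
    exact (ENNReal.ofReal_lt_ofReal_iff (by positivity)).2 h
  obtain ⟨γ, h0, h1, hγ, hlen⟩ := exists_lt_of_riemannianEDist_lt hlt
  have hsum : ∀ t ∈ Icc (0 : ℝ) 1, dist x (γ t) + dist (γ t) y < r + s := by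
    intro t ht
    have hleft : edist x (γ t) ≤ pathELength 𝓘(ℝ, E) γ 0 t := by
      rw [IsRiemannianManifold.out (I := 𝓘(ℝ, E))]
      exact riemannianEDist_le_pathELength (hγ.mono (Icc_subset_Icc le_rfl ht.2)) h0 rfl ht.1
    have hright : edist (γ t) y ≤ pathELength 𝓘(ℝ, E) γ t 1 := by
      rw [IsRiemannianManifold.out (I := 𝓘(ℝ, E))]
      exact riemannianEDist_le_pathELength (hγ.mono (Icc_subset_Icc ht.1 le_rfl)) rfl h1 ht.2
    have htotal : edist x (γ t) + edist (γ t) y < ENNReal.ofReal (r + s) :=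
      ((add_le_add hleft hright).trans_eq (pathELength_add ht.1 ht.2)).trans_lt hlen
    rw [edist_dist, edist_dist, ← ENNReal.ofReal_add dist_nonneg dist_nonneg] at htotal
    exact (ENNReal.ofReal_lt_ofReal_iff (by positivity)).1 htotal
  have hpre : IsPreconnected (γ '' Icc 0 1) := isPreconnected_Icc.image γ hγ.continuousOn
  obtain ⟨z, -, hz⟩ := hpre {z | dist x z < r} {z | dist z y < s}
    (isOpen_lt (by fun_prop) (by fun_prop)) (isOpen_lt (by fun_prop) (by fun_prop))
    (by
      rintro _ ⟨t, ht, rfl⟩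
      by_contra hcon
      simp only [mem_union, mem_ofPred_eq, not_or, not_lt] at hcon
      linarith [hsum t ht])
    ⟨x, ⟨0, by simp, h0⟩, by simpa using hr⟩ ⟨y, ⟨1, by simp, h1⟩, by simpa using hs⟩
  exact ⟨z, hz⟩

end RiemannianDistance

section VanishingOnAxes

variable {X Y Z : Type*} [NormedAddCommGroup X] [NormedSpace ℝ X] [NormedAddCommGroup Y]
  [NormedSpace ℝ Y] [NormedAddCommGroup Z] [NormedSpace ℝ Z] {f : X × Y → Z} {a : X} {b : Y}

theorem exists_norm_fderiv_comp_inl_le_of_vanishing (hf : ContDiffAt ℝ 2 f (a, b))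
    (hb : ∀ᶠ x in 𝓝 a, f (x, b) = 0) :
    ∃ K : ℝ≥0, ∀ᶠ p in 𝓝 (a, b),
      ‖(fderiv ℝ f p).comp (ContinuousLinearMap.inl ℝ X Y)‖ ≤ K * ‖p.2 - b‖ := by
  obtain ⟨K, t, ht, hK⟩ :=
    (hf.fderiv_right (m := 1) (by norm_num)).exists_lipschitzOnWith
  have hdiff : ∀ᶠ p in 𝓝 (a, b), DifferentiableAt ℝ f p :=
    (hf.eventually (by simp)).mono fun p hp ↦ hp.differentiableAt (by simp)
  have haxis : Tendsto (fun p : X × Y ↦ (p.1, b)) (𝓝 (a, b)) (𝓝 (a, b)) :=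
    Continuous.tendsto' (by fun_prop) _ _ rfl
  refine ⟨K, ?_⟩
  filter_upwards [ht, haxis.eventually ht, haxis.eventually hdiff,
    (continuous_fst.tendsto (a, b)).eventually hb.eventually_nhds] with p hp hpb hdb hzero
  have hpartial : (fderiv ℝ f (p.1, b)).comp (ContinuousLinearMap.inl ℝ X Y) = 0 :=
    (hdb.hasFDerivAt.comp p.1 (hasFDerivAt_prodMk_left p.1 b)).unique
      ((hasFDerivAt_const (0 : Z) p.1).congr_of_eventuallyEq hzero)
  calc ‖(fderiv ℝ f p).comp (ContinuousLinearMap.inl ℝ X Y)‖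
      = ‖(fderiv ℝ f p - fderiv ℝ f (p.1, b)).comp (ContinuousLinearMap.inl ℝ X Y)‖ := by
        rw [ContinuousLinearMap.sub_comp, hpartial, sub_zero]
    _ ≤ ‖fderiv ℝ f p - fderiv ℝ f (p.1, b)‖ * 1 :=
        (ContinuousLinearMap.opNorm_comp_le _ _).trans
          (by gcongr; exact ContinuousLinearMap.norm_inl_le_one ℝ X Y)
    _ ≤ K * ‖p - (p.1, b)‖ := by rw [mul_one]; exact hK.norm_sub_le hp hpb
    _ = K * ‖p.2 - b‖ := by simp [Prod.norm_def]

theorem exists_norm_le_mul_norm_mul_norm_of_vanishing (hf : ContDiffAt ℝ 2 f (a, b))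
    (ha : ∀ᶠ y in 𝓝 b, f (a, y) = 0) (hb : ∀ᶠ x in 𝓝 a, f (x, b) = 0) :
    ∃ K : ℝ≥0, ∀ᶠ p in 𝓝 (a, b), ‖f p‖ ≤ K * ‖p.1 - a‖ * ‖p.2 - b‖ := by
  obtain ⟨K, hK⟩ := exists_norm_fderiv_comp_inl_le_of_vanishing hf hb
  have hdiff : ∀ᶠ p in 𝓝 (a, b), DifferentiableAt ℝ f p :=
    (hf.eventually (by simp)).mono fun p hp ↦ hp.differentiableAt (by simp)
  obtain ⟨ε, hε, hball⟩ := Metric.eventually_nhds_iff_ball.1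
    ((hK.and hdiff).and ((continuous_snd.tendsto (a, b)).eventually ha))
  refine ⟨K, Metric.eventually_nhds_iff_ball.2 ⟨ε, hε, fun ⟨x, y⟩ hxy ↦ ?_⟩⟩
  rw [← ball_prod_same] at hxy hball
  have hmean := (convex_ball a ε).norm_image_sub_le_of_norm_hasFDerivWithin_le
    (f := fun x ↦ f (x, y)) (C := K * ‖y - b‖)
    (f' := fun x ↦ (fderiv ℝ f (x, y)).comp (ContinuousLinearMap.inl ℝ X Y))
    (fun x hx ↦ ((hball (x, y) ⟨hx, hxy.2⟩).1.2.hasFDerivAt.comp x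
      (hasFDerivAt_prodMk_left x y)).hasFDerivWithinAt)
    (fun x hx ↦ (hball (x, y) ⟨hx, hxy.2⟩).1.1) (Metric.mem_ball_self hε) hxy.1
  rw [(hball (x, y) hxy).2, sub_zero] at hmean
  exact hmean.trans_eq (mul_right_comm _ _ _)

end VanishingOnAxes

section CenteredChart

variable (E : Type*) [NormedAddCommGroup E] [NormedSpace ℝ E]
  (G : Type*) [Group G] [TopologicalSpace G] [ChartedSpace E G]

/-- The preferred chart of a Lie group at the identity, translated so as to vanish there. -/
noncomputable def centeredChart (x : G) : E :=
  extChartAt 𝓘(ℝ, E) (1 : G) x - extChartAt 𝓘(ℝ, E) (1 : G) 1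

theorem centeredChart_one : centeredChart E G 1 = 0 := sub_self _

theorem continuousAt_centeredChart : ContinuousAt (centeredChart E G) 1 :=
  (continuousAt_extChartAt 1).sub continuousAt_const

variable [LieGroup 𝓘(ℝ, E) ∞ G]

theorem contDiffAt_extChartAt_mul :
    ContDiffAt ℝ ∞ (fun p : E × E ↦ extChartAt 𝓘(ℝ, E) (1 : G)
        ((extChartAt 𝓘(ℝ, E) (1 : G)).symm p.1 * (extChartAt 𝓘(ℝ, E) (1 : G)).symm p.2))
      (extChartAt 𝓘(ℝ, E) (1 : G) 1, extChartAt 𝓘(ℝ, E) (1 : G) 1) := by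
  set χ := extChartAt 𝓘(ℝ, E) (1 : G)
  have hsymm : ContMDiffAt 𝓘(ℝ, E) 𝓘(ℝ, E) ∞ χ.symm (χ 1) :=
    (contMDiffOn_extChartAt_symm (I := 𝓘(ℝ, E)) (n := ∞) (1 : G)).contMDiffAt
      (extChartAt_target_mem_nhds (I := 𝓘(ℝ, E)) (1 : G))
  have hχ : ContMDiffAt 𝓘(ℝ, E) 𝓘(ℝ, E) ∞ χ (χ.symm (χ 1) * χ.symm (χ 1)) := by
    rw [extChartAt_to_inv (I := 𝓘(ℝ, E)) (1 : G), one_mul]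
    exact contMDiffAt_extChartAt
  have hmul : ContMDiffAt 𝓘(ℝ, E × E) 𝓘(ℝ, E) ∞
      (fun p : E × E ↦ χ.symm p.1 * χ.symm p.2) (χ 1, χ 1) :=
    (ContMDiffAt.comp (χ 1, χ 1) (g := χ.symm) hsymm contDiffAt_fst.contMDiffAt).mul
      (ContMDiffAt.comp (χ 1, χ 1) (g := χ.symm) hsymm contDiffAt_snd.contMDiffAt)
  exact (ContMDiffAt.comp (χ 1, χ 1) (g := χ) hχ hmul).contDiffAt

theorem exists_norm_centeredChart_mul_sub_le :
    ∃ K : ℝ≥0, ∀ᶠ p in 𝓝 ((1, 1) : G × G),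
      ‖centeredChart E G (p.1 * p.2) - centeredChart E G p.1 - centeredChart E G p.2‖ ≤
        K * ‖centeredChart E G p.1‖ * ‖centeredChart E G p.2‖ := by
  set χ := extChartAt 𝓘(ℝ, E) (1 : G) with hχ
  have hone : χ.symm (χ 1) = 1 := extChartAt_to_inv (I := 𝓘(ℝ, E)) (1 : G)
  have htarget : ∀ᶠ y in 𝓝 (χ 1), y ∈ χ.target :=
    extChartAt_target_mem_nhds (I := 𝓘(ℝ, E)) (1 : G)
  have hsource : ∀ᶠ x in 𝓝 (1 : G), x ∈ χ.source :=
    extChartAt_source_mem_nhds (I := 𝓘(ℝ, E)) (1 : G)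
  let f : E × E → E := fun p ↦ χ (χ.symm p.1 * χ.symm p.2) - p.1 - p.2 + χ 1
  have hf : ContDiffAt ℝ ∞ f (χ 1, χ 1) :=
    (((contDiffAt_extChartAt_mul E G).sub contDiffAt_fst).sub contDiffAt_snd).add contDiffAt_const
  obtain ⟨K, hK⟩ := exists_norm_le_mul_norm_mul_norm_of_vanishing (contDiffAt_infty.1 hf 2)
    (htarget.mono fun y hy ↦ by simp [f, hone, χ.right_inv hy])
    (htarget.mono fun y hy ↦ by simp [f, hone, χ.right_inv hy])
  have hχ_tendsto : Tendsto (fun p : G × G ↦ (χ p.1, χ p.2)) (𝓝 (1, 1)) (𝓝 (χ 1, χ 1)) := by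
    rw [nhds_prod_eq, nhds_prod_eq]
    exact Tendsto.prodMap (continuousAt_extChartAt 1) (continuousAt_extChartAt 1)
  refine ⟨K, ?_⟩
  filter_upwards [hχ_tendsto.eventually hK, hsource.prod_nhds hsource] with p hp hps
  simp only [f, χ.left_inv hps.1, χ.left_inv hps.2] at hp
  have hf_eq : centeredChart E G (p.1 * p.2) - centeredChart E G p.1 - centeredChart E G p.2 =
      χ (p.1 * p.2) - χ p.1 - χ p.2 + χ 1 := by
    simp only [centeredChart, ← hχ]
    abel
  rw [hf_eq]
  exact hp

end CenteredChart

section GleasonMetric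

/-- Gleason's conditions on a left-invariant metric on a group: small elements have powers escaping
at linear speed, and commutators of small elements are quadratically small. They hold for every
left-invariant Riemannian distance on a Lie group. -/
structure IsGleasonMetric (G : Type*) [SeminormedGroup G] (C δ : ℝ) : Prop where
  one_le : 1 ≤ C
  pos : 0 < δ
  escape : ∀ (g : G) (n : ℕ), n * ‖g‖ ≤ δ → n * ‖g‖ ≤ C * ‖g ^ n‖
  commutator : ∀ x y : G, ‖x‖ ≤ δ → ‖y‖ ≤ δ → dist (x * y) (y * x) ≤ C * ‖x‖ * ‖y‖

namespace IsGleasonMetric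

variable {G : Type*} [SeminormedGroup G] {C δ : ℝ}

theorem mul_norm_le_of_norm_pow_le (h : IsGleasonMetric G C δ) {η : ℝ} (hη : (C + 1) * η ≤ δ)
    (w : G) (M : ℕ) (hw : ∀ k ≤ M, ‖w ^ k‖ ≤ η) : M * ‖w‖ ≤ C * η := by
  have hC := h.one_le
  induction M with
  | zero =>
    have hη0 : 0 ≤ η := (norm_nonneg' _).trans (hw 0 le_rfl)
    simpa using mul_nonneg (by linarith) hη0
  | succ M ih =>
    have hM : M * ‖w‖ ≤ C * η := ih fun k hk ↦ hw k (hk.trans (Nat.le_succ M))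
    have hone : ‖w‖ ≤ η := by simpa using hw 1 (by simp)
    have hescape := h.escape w (M + 1) (by push_cast; linarith)
    exact hescape.trans (mul_le_mul_of_nonneg_left (hw _ le_rfl) (by linarith))

theorem norm_conj_le (h : IsGleasonMetric G C δ) {x u : G} (hx : ‖x‖ ≤ δ) (hu : ‖u‖ ≤ δ) :
    ‖x⁻¹ * u * x‖ ≤ (1 + C * ‖x‖) * ‖u‖ := by
  have hdist : ‖x⁻¹ * u * x‖ = dist x (u * x) := by rw [dist_eq_norm_inv_mul, mul_assoc]
  have htranslate : dist x (x * u) = ‖u‖ := by rw [dist_eq_norm_inv_mul, inv_mul_cancel_left]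
  rw [hdist]
  linarith [dist_triangle x (x * u) (u * x), h.commutator x u hx hu]

theorem subgroup (h : IsGleasonMetric G C δ) (H : Subgroup G) : IsGleasonMetric H C δ where
  one_le := h.one_le
  pos := h.pos
  escape g n hn := h.escape g n hn
  commutator x y hx hy := h.commutator x y hx hy

end IsGleasonMetric

end GleasonMetric

section LengthGroup

/-- A left-invariant metric on a group is a length metric: a bound `r + s` on the norm of an
element splits into bounds `r` and `s` on the norms of two factors. -/
def IsLengthGroup (G : Type*) [SeminormedGroup G] : Prop :=
  ∀ (g : G) (r s : ℝ), 0 < r → 0 < s → ‖g‖ < r + s → ∃ h k : G, g = h * k ∧ ‖h‖ < r ∧ ‖k‖ < s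

variable {G : Type*} [SeminormedGroup G]

theorem IsLengthGroup.le_nat_mul_of_subadditive (hl : IsLengthGroup G) {f : G → ℝ}
    (hf : ∀ x y, f (x * y) ≤ f x + f y) {R D : ℝ} (hR : 0 < R) (hloc : ∀ x, ‖x‖ < R → f x ≤ D)
    (n : ℕ) (x : G) (hx : ‖x‖ < (n + 1) * R) : f x ≤ (n + 1) * D := by
  induction n generalizing x with
  | zero => simpa using hloc x (by simpa using hx)
  | succ n ih =>
    obtain ⟨h, k, rfl, hh, hk⟩ := hl x ((n + 1) * R) R (by positivity) hR
      (by push_cast at hx; linarith)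
    push_cast
    linarith [hf h k, ih h hh, hloc k hk]

theorem IsLengthGroup.le_mul_norm_of_subadditive (hl : IsLengthGroup G) {f : G → ℝ}
    (hf : ∀ x y, f (x * y) ≤ f x + f y) {C ε : ℝ} (hC : 0 ≤ C) (hε : 0 < ε)
    (hloc : ∀ x, ‖x‖ < ε → f x ≤ C * ‖x‖) (x : G) : f x ≤ C * ‖x‖ := by
  have hlt : ∀ R, ‖x‖ < R → f x ≤ C * R := by
    intro R hR
    have hR0 : 0 < R := (norm_nonneg' x).trans_lt hR
    obtain ⟨n, hn⟩ := exists_nat_gt (R / ε)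
    have hstep : R / (n + 1) ≤ ε := by
      rw [div_lt_iff₀ hε] at hn
      rw [div_le_iff₀ (by positivity)]
      linarith
    have hle := hl.le_nat_mul_of_subadditive hf (R := R / (n + 1)) (D := C * (R / (n + 1)))
      (by positivity) (fun y hy ↦ (hloc y (hy.trans_le hstep)).trans (by gcongr)) n x
      (by rwa [mul_div_cancel₀ _ (by positivity)])
    calc f x ≤ (n + 1) * (C * (R / (n + 1))) := hle
      _ = C * R := by field_simp
  have htendsto : Tendsto (fun R ↦ C * R) (𝓝[>] ‖x‖) (𝓝 (C * ‖x‖)) :=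
    ((continuous_const.mul continuous_id).tendsto ‖x‖).mono_left nhdsWithin_le_nhds
  exact ge_of_tendsto htendsto (eventually_mem_nhdsWithin.mono fun R hR ↦ hlt R hR)

end LengthGroup

section GleasonChart

/-- `ψ` is a chart on the `ρ`-ball of a group in which the multiplication is the addition up to an
error at most `C₀` times the product of the norms, and which controls the metric from above. -/
structure IsGleasonChart {G E : Type*} [SeminormedGroup G] [SeminormedAddCommGroup E]
    (ψ : G → E) (C₀ C₁ ρ : ℝ) : Prop where
  pos_mul : 0 < C₀
  pos_norm : 0 < C₁
  pos : 0 < ρ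
  map_one : ψ 1 = 0
  norm_mul_sub_le : ∀ x y, ‖x‖ < ρ → ‖y‖ < ρ → ‖ψ (x * y) - ψ x - ψ y‖ ≤ C₀ * ‖ψ x‖ * ‖ψ y‖
  norm_le : ∀ x, ‖x‖ < ρ → ‖x‖ ≤ C₁ * ‖ψ x‖
  mul_norm_le : ∀ x, ‖x‖ < ρ → C₀ * ‖ψ x‖ ≤ 1 / 2

namespace IsGleasonChart

variable {G E : Type*} [SeminormedAddCommGroup E] {C₀ C₁ ρ : ℝ}

section SeminormedGroup

variable [SeminormedGroup G] {ψ : G → E} (h : IsGleasonChart ψ C₀ C₁ ρ)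
include h

theorem norm_mul_sub_le_half {x y : G} (hx : ‖x‖ < ρ) (hy : ‖y‖ < ρ) :
    ‖ψ (x * y) - ψ x - ψ y‖ ≤ 1 / 2 * ‖ψ y‖ :=
  (h.norm_mul_sub_le x y hx hy).trans (by gcongr; exact h.mul_norm_le x hx)

theorem norm_commutator_le {x y : G} (hx : ‖x‖ ≤ ρ / 8) (hy : ‖y‖ ≤ ρ / 8) :
    ‖ψ ((x * y)⁻¹ * (y * x))‖ ≤ 4 * C₀ * ‖ψ x‖ * ‖ψ y‖ := by
  have hρ := h.pos
  set z := (x * y)⁻¹ * (y * x) with hz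
  have hxy : ‖x * y‖ ≤ ρ / 4 := (norm_mul_le' x y).trans (by linarith)
  have hyx : ‖y * x‖ ≤ ρ / 4 := (norm_mul_le' y x).trans (by linarith)
  have hzρ : ‖z‖ ≤ ρ / 2 := (norm_mul_le' _ _).trans (by rw [norm_inv']; linarith)
  have hψxy := h.norm_mul_sub_le x y (by linarith) (by linarith)
  have hψyx := h.norm_mul_sub_le y x (by linarith) (by linarith)
  have hψz := h.norm_mul_sub_le_half (x := x * y) (y := z) (by linarith) (by linarith)
  rw [hz, mul_inv_cancel_left, ← hz] at hψz
  have hsplit : ψ z = (ψ (y * x) - ψ y - ψ x) - (ψ (x * y) - ψ x - ψ y) -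
      (ψ (y * x) - ψ (x * y) - ψ z) := by abel
  have htriangle : ‖ψ z‖ ≤ ‖ψ (y * x) - ψ y - ψ x‖ + ‖ψ (x * y) - ψ x - ψ y‖ +
      ‖ψ (y * x) - ψ (x * y) - ψ z‖ := by
    conv_lhs => rw [hsplit]
    exact (norm_sub_le _ _).trans (add_le_add_left (norm_sub_le _ _) _)
  linarith [mul_right_comm C₀ ‖ψ x‖ ‖ψ y‖]

variable [NormedSpace ℝ E]

theorem norm_pow_sub_smul_le {g : G} {n : ℕ} (hn : n * ‖g‖ < ρ) :
    ‖ψ (g ^ n) - (n : ℝ) • ψ g‖ ≤ n / 2 * ‖ψ g‖ := by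
  induction n with
  | zero => simp [h.map_one]
  | succ n ih =>
    push_cast at hn
    have hg : ‖g‖ < ρ := by nlinarith [mul_nonneg n.cast_nonneg (norm_nonneg' g)]
    have hpow : n * ‖g‖ < ρ := by linarith [norm_nonneg' g]
    have hstep := h.norm_mul_sub_le_half (norm_pow_le_mul_norm.trans_lt hpow) hg
    have hsplit : ψ (g ^ (n + 1)) - ((n + 1 : ℕ) : ℝ) • ψ g =
        (ψ (g ^ n * g) - ψ (g ^ n) - ψ g) + (ψ (g ^ n) - (n : ℝ) • ψ g) := by
      rw [pow_succ]
      push_cast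
      rw [add_smul, one_smul]
      abel
    rw [hsplit]
    push_cast
    linarith [norm_add_le (ψ (g ^ n * g) - ψ (g ^ n) - ψ g) (ψ (g ^ n) - (n : ℝ) • ψ g), ih hpow]

theorem mul_norm_le_two_mul_norm_pow {g : G} {n : ℕ} (hn : n * ‖g‖ < ρ) :
    n * ‖ψ g‖ ≤ 2 * ‖ψ (g ^ n)‖ := by
  have hsub := norm_sub_norm_le ((n : ℝ) • ψ g) (ψ (g ^ n))
  rw [norm_sub_rev, norm_smul, Real.norm_natCast] at hsub
  linarith [h.norm_pow_sub_smul_le hn]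

end SeminormedGroup

variable [NormedGroup G] [NormedSpace ℝ E] {ψ : G → E} (h : IsGleasonChart ψ C₀ C₁ ρ)
include h

theorem norm_chart_le {g : G} (hg : ‖g‖ ≤ ρ / 2) : ‖ψ g‖ ≤ 4 / (C₀ * ρ) * ‖g‖ := by
  have hρ := h.pos
  have hC₀ := h.pos_mul
  rcases (norm_nonneg' g).eq_or_lt with h0 | h0
  · simp [norm_eq_zero'.1 h0.symm, h.map_one]
  -- The largest power of `g` of norm at most `ρ / 2` still lies in the chart.
  set n := ⌊ρ / (2 * ‖g‖)⌋₊
  have hn1 : (1 : ℝ) ≤ n :=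
    mod_cast Nat.le_floor (by rw [Nat.cast_one, le_div_iff₀ (by positivity)]; linarith)
  have hn_le : n * (2 * ‖g‖) ≤ ρ := (le_div_iff₀ (by positivity)).1 (Nat.floor_le (by positivity))
  have hn_lt : ρ < (n + 1) * (2 * ‖g‖) := (div_lt_iff₀ (by positivity)).1 (Nat.lt_floor_add_one _)
  have hpow := h.mul_norm_le_two_mul_norm_pow (g := g) (n := n) (by linarith)
  have hsmall := h.mul_norm_le (g ^ n) (norm_pow_le_mul_norm.trans_lt (by linarith))
  rw [div_mul_eq_mul_div, le_div_iff₀ (by positivity)]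
  calc ‖ψ g‖ * (C₀ * ρ) ≤ ‖ψ g‖ * (C₀ * (4 * n * ‖g‖)) := by gcongr; nlinarith
    _ = 4 * (C₀ * (n * ‖ψ g‖)) * ‖g‖ := by ring
    _ ≤ 4 * (C₀ * (2 * ‖ψ (g ^ n)‖)) * ‖g‖ := by gcongr
    _ ≤ 4 * ‖g‖ := by gcongr; linarith

theorem isGleasonMetric :
    IsGleasonMetric G (max 1 (max (2 * C₁ * (4 / (C₀ * ρ))) (4 * C₀ * C₁ * (4 / (C₀ * ρ)) ^ 2)))
      (ρ / 8) where
  one_le := le_max_left _ _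
  pos := by linarith [h.pos]
  escape g n hn := by
    have hρ := h.pos
    have hC₁ := h.pos_norm
    have hpow : ‖g ^ n‖ ≤ ρ / 8 := norm_pow_le_mul_norm.trans hn
    rcases Nat.eq_zero_or_pos n with rfl | hn0
    · simp
    have hg : ‖g‖ ≤ n * ‖g‖ :=
      le_mul_of_one_le_left (norm_nonneg' g) (mod_cast hn0)
    calc n * ‖g‖ ≤ n * (C₁ * ‖ψ g‖) := by gcongr; exact h.norm_le g (by linarith)
      _ = C₁ * (n * ‖ψ g‖) := by ring
      _ ≤ C₁ * (2 * ‖ψ (g ^ n)‖) :=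
        mul_le_mul_of_nonneg_left (h.mul_norm_le_two_mul_norm_pow (by linarith)) hC₁.le
      _ ≤ C₁ * (2 * (4 / (C₀ * ρ) * ‖g ^ n‖)) := by
        gcongr
        exact h.norm_chart_le (by linarith)
      _ = 2 * C₁ * (4 / (C₀ * ρ)) * ‖g ^ n‖ := by ring
      _ ≤ _ := by gcongr; simp
  commutator x y hx hy := by
    have hρ := h.pos
    have hC₀ := h.pos_mul
    have hC₁ := h.pos_norm
    have hz : ‖(x * y)⁻¹ * (y * x)‖ < ρ := by
      have := norm_mul_le' (x * y)⁻¹ (y * x)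
      rw [norm_inv'] at this
      linarith [norm_mul_le' x y, norm_mul_le' y x]
    calc dist (x * y) (y * x) = ‖(x * y)⁻¹ * (y * x)‖ := dist_eq_norm_inv_mul _ _
      _ ≤ C₁ * (4 * C₀ * ‖ψ x‖ * ‖ψ y‖) :=
        (h.norm_le _ hz).trans (by gcongr; exact h.norm_commutator_le hx hy)
      _ ≤ C₁ * (4 * C₀ * (4 / (C₀ * ρ) * ‖x‖) * (4 / (C₀ * ρ) * ‖y‖)) := by
        gcongr <;> exact h.norm_chart_le (by linarith)
      _ = 4 * C₀ * C₁ * (4 / (C₀ * ρ)) ^ 2 * ‖x‖ * ‖y‖ := by ring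
      _ ≤ _ := by gcongr; simp

end IsGleasonChart

theorem exists_isGleasonChart {G E : Type*} [SeminormedGroup G] [SeminormedAddCommGroup E]
    {ψ : G → E} (hψ : ContinuousAt ψ 1) (hψ1 : ψ 1 = 0) {C₀ C₁ : ℝ≥0}
    (hmul : ∀ᶠ p in 𝓝 ((1, 1) : G × G),
      ‖ψ (p.1 * p.2) - ψ p.1 - ψ p.2‖ ≤ C₀ * ‖ψ p.1‖ * ‖ψ p.2‖)
    (hnorm : ∀ᶠ x in 𝓝 (1 : G), ‖x‖ ≤ C₁ * ‖ψ x‖) :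
    ∃ C₀ C₁ ρ, IsGleasonChart ψ C₀ C₁ ρ := by
  have hsmall : ∀ᶠ x in 𝓝 (1 : G), (C₀ + 1) * ‖ψ x‖ < 1 / 2 := by
    have htendsto : Tendsto (fun x ↦ (C₀ + 1) * ‖ψ x‖) (𝓝 1) (𝓝 0) := by
      simpa [hψ1] using hψ.norm.tendsto.const_mul ((C₀ : ℝ) + 1)
    exact htendsto.eventually (gt_mem_nhds (by norm_num))
  obtain ⟨ρ₁, hρ₁, hball₁⟩ := Metric.eventually_nhds_iff_ball.1 hmul
  obtain ⟨ρ₂, hρ₂, hball₂⟩ := Metric.eventually_nhds_iff_ball.1 (hnorm.and hsmall)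
  have hmem : ∀ {x : G} {r : ℝ}, ‖x‖ < r → x ∈ Metric.ball 1 r := fun hx ↦ by
    rwa [Metric.mem_ball, dist_one_right]
  refine ⟨C₀ + 1, C₁ + 1, min ρ₁ ρ₂, by positivity, by positivity, by positivity, hψ1,
    fun x y hx hy ↦ ?_, fun x hx ↦ ?_, fun x hx ↦ ?_⟩
  · refine (hball₁ (x, y) ?_).trans (by gcongr; simp)
    rw [← ball_prod_same]
    exact ⟨hmem (hx.trans_le (min_le_left _ _)), hmem (hy.trans_le (min_le_left _ _))⟩
  · exact (hball₂ x (hmem (hx.trans_le (min_le_right _ _)))).1.trans (by gcongr; simp)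
  · exact (hball₂ x (hmem (hx.trans_le (min_le_right _ _)))).2.le

end GleasonChart

section RiemannianGroup

variable {E : Type*} [NormedAddCommGroup E] [NormedSpace ℝ E] {G : Type*}

theorem exists_isGleasonMetric_of_isRiemannianManifold [NormedGroup G] [ChartedSpace E G]
    [LieGroup 𝓘(ℝ, E) ∞ G] [Bundle.RiemannianBundle (fun x : G ↦ TangentSpace 𝓘(ℝ, E) x)]
    [IsContinuousRiemannianBundle E (fun x : G ↦ TangentSpace 𝓘(ℝ, E) x)]
    [IsRiemannianManifold 𝓘(ℝ, E) G] :
    ∃ C δ : ℝ, IsGleasonMetric G C δ := by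
  obtain ⟨C₀, hC₀⟩ := exists_norm_centeredChart_mul_sub_le E G
  obtain ⟨C₁, -, hC₁⟩ := eventually_riemannianEDist_le_edist_extChartAt 𝓘(ℝ, E) (1 : G)
  have hnorm : ∀ᶠ x in 𝓝 (1 : G), ‖x‖ ≤ C₁ * ‖centeredChart E G x‖ := by
    filter_upwards [hC₁] with x hx
    rw [← IsRiemannianManifold.out (I := 𝓘(ℝ, E)), edist_dist, edist_dist,
      ← ENNReal.ofReal_coe_nnreal, ← ENNReal.ofReal_mul (by simp),
      ENNReal.ofReal_le_ofReal_iff (by positivity)] at hx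
    rwa [centeredChart, ← dist_eq_norm, dist_comm (extChartAt 𝓘(ℝ, E) (1 : G) x),
      ← dist_one_left]
  obtain ⟨C₀, C₁, ρ, hchart⟩ := exists_isGleasonChart (continuousAt_centeredChart E G)
    (centeredChart_one E G) hC₀ hnorm
  exact ⟨_, _, hchart.isGleasonMetric⟩

theorem isLengthGroup_of_isRiemannianManifold [SeminormedGroup G] [ChartedSpace E G]
    [Bundle.RiemannianBundle (fun x : G ↦ TangentSpace 𝓘(ℝ, E) x)]
    [IsRiemannianManifold 𝓘(ℝ, E) G] : IsLengthGroup G := by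
  intro g r s hr hs hg
  obtain ⟨z, hz₁, hz₂⟩ := exists_dist_lt_dist_lt_of_isRiemannianManifold (E := E)
    (x := 1) (y := g) hr hs (by rwa [dist_one_left])
  exact ⟨z, z⁻¹ * g, by simp, by rwa [← dist_one_left], by rwa [← dist_eq_norm_inv_mul]⟩

end RiemannianGroup

section OneParameterSubgroup

/-- The Lipschitz one-parameter subgroups of an abelian group `A` with an invariant metric, normed
by their optimal Lipschitz constant: the Lie algebra of `A` together with its metric norm. Since `A`
is written multiplicatively, they are the bounded homomorphisms from `ℝ` to `Additive A`. -/
def OneParameterSubgroup (A : Type*) [NormedCommGroup A] : Type _ :=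
  NormedAddGroupHom ℝ (Additive A)

namespace OneParameterSubgroup

variable {A : Type*} [NormedCommGroup A]

noncomputable instance : NormedAddCommGroup (OneParameterSubgroup A) :=
  inferInstanceAs (NormedAddCommGroup (NormedAddGroupHom ℝ (Additive A)))

instance : FunLike (OneParameterSubgroup A) ℝ A where
  coe φ t := (NormedAddGroupHom.toFun φ t).toMul
  coe_injective _ _ h := NormedAddGroupHom.ext fun t ↦ congrFun h t

@[simp] theorem zero_apply (t : ℝ) : (0 : OneParameterSubgroup A) t = 1 := rfl

@[simp] theorem add_apply (φ ψ : OneParameterSubgroup A) (t : ℝ) : (φ + ψ) t = φ t * ψ t := rfl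

theorem norm_apply_le (φ : OneParameterSubgroup A) (t : ℝ) : ‖φ t‖ ≤ ‖φ‖ * |t| :=
  NormedAddGroupHom.le_opNorm φ t

theorem norm_le (φ : OneParameterSubgroup A) {K : ℝ} (hK : 0 ≤ K) (h : ∀ t, ‖φ t‖ ≤ K * |t|) :
    ‖φ‖ ≤ K :=
  NormedAddGroupHom.opNorm_le_bound φ hK h

theorem map_add (φ : OneParameterSubgroup A) (s t : ℝ) : φ (s + t) = φ s * φ t :=
  NormedAddGroupHom.map_add' φ s t

theorem map_intCast_mul (φ : OneParameterSubgroup A) (n : ℤ) (t : ℝ) : φ (n * t) = φ t ^ n := by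
  rw [← zsmul_eq_mul]
  exact map_zsmul (NormedAddGroupHom.toAddMonoidHom φ) n t

theorem continuous (φ : OneParameterSubgroup A) : Continuous φ :=
  continuous_toMul.comp (NormedAddGroupHom.continuous φ)

theorem exists_forall_apply_eq {f : ℝ → A} {K : ℝ} (hK : 0 ≤ K)
    (hadd : ∀ s t, f (s + t) = f s * f t) (hf : ∀ t, ‖f t‖ ≤ K * |t|) :
    ∃ φ : OneParameterSubgroup A, ‖φ‖ ≤ K ∧ ∀ t, φ t = f t :=
  ⟨(AddMonoidHom.mk' (fun t ↦ Additive.ofMul (f t)) hadd).mkNormedAddGroupHom K hf,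
    NormedAddGroupHom.mkNormedAddGroupHom_norm_le _ hK hf, fun _ ↦ rfl⟩

noncomputable instance : SMul ℝ (OneParameterSubgroup A) where
  smul c φ := NormedAddGroupHom.comp φ
    ((AddMonoidHom.mulRight c).mkNormedAddGroupHom ‖c‖ fun t ↦ by
      rw [AddMonoidHom.coe_mulRight, norm_mul, mul_comm])

@[simp] theorem smul_apply (c : ℝ) (φ : OneParameterSubgroup A) (t : ℝ) :
    (c • φ) t = φ (t * c) := rfl

noncomputable instance : Module ℝ (OneParameterSubgroup A) where
  one_smul φ := DFunLike.ext _ _ fun t ↦ by simp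
  mul_smul c d φ := DFunLike.ext _ _ fun t ↦ by simp [mul_assoc]
  smul_zero c := rfl
  smul_add c φ ψ := rfl
  add_smul c d φ := DFunLike.ext _ _ fun t ↦ by simp [mul_add, φ.map_add]
  zero_smul φ := DFunLike.ext _ _ fun t ↦ by simpa using φ.map_intCast_mul 0 t

noncomputable instance : NormedSpace ℝ (OneParameterSubgroup A) where
  norm_smul_le c φ := norm_le _ (by positivity) fun t ↦ by
    rw [smul_apply, Real.norm_eq_abs]
    exact (φ.norm_apply_le _).trans_eq (by rw [abs_mul]; ring)

theorem norm_le_mul_norm_apply_one {C δ : ℝ} (h : IsGleasonMetric A C δ)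
    (φ : OneParameterSubgroup A) (hφ : ‖φ‖ ≤ δ) : ‖φ‖ ≤ C * ‖φ 1‖ := by
  have hC : 0 ≤ C := by linarith [h.one_le]
  refine φ.norm_le (by positivity) fun t ↦ ?_
  refine Rat.denseRange_cast.induction_on t
    (isClosed_le φ.continuous.norm' (continuous_const.mul continuous_abs)) fun q ↦ ?_
  have hden : (0 : ℝ) < q.den := mod_cast q.den_pos
  set s : ℝ := (q.den : ℝ)⁻¹
  have hpow : φ s ^ q.den = φ 1 := by
    rw [← zpow_natCast, ← map_intCast_mul, Int.cast_natCast, mul_inv_cancel₀ hden.ne']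
  have hspeed : q.den * ‖φ s‖ ≤ ‖φ‖ := by
    calc q.den * ‖φ s‖ ≤ q.den * (‖φ‖ * |s|) := by gcongr; exact φ.norm_apply_le s
      _ = ‖φ‖ := by rw [abs_of_pos (inv_pos.2 hden)]; field_simp
  have hescape : q.den * ‖φ s‖ ≤ C * ‖φ 1‖ := by
    simpa only [hpow] using h.escape (φ s) q.den (hspeed.trans hφ)
  have hq : (q : ℝ) = q.num * s := by rw [← div_eq_mul_inv, ← Rat.cast_def]
  calc ‖φ q‖ = ‖φ s ^ q.num‖ := by rw [hq, map_intCast_mul]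
    _ ≤ |(q.num : ℝ)| * ‖φ s‖ := by
      simpa only [Int.norm_eq_abs] using norm_zpow_le_mul_norm q.num (φ s)
    _ = |(q.num : ℝ)| * s * (q.den * ‖φ s‖) := by simp only [s]; field_simp
    _ ≤ |(q.num : ℝ)| * s * (C * ‖φ 1‖) := by gcongr
    _ = C * ‖φ 1‖ * |(q : ℝ)| := by rw [hq, abs_mul, abs_of_pos (inv_pos.2 hden)]; ring

theorem exists_tendsto_of_approx [ProperSpace A] {ι : Type*} (𝒰 : Ultrafilter ι) {f : ι → ℝ → A}
    {K : ℝ} (hK : 0 ≤ K) {ε : ι → ℝ} (hε : Tendsto ε 𝒰 (𝓝 0))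
    (hf : ∀ i t, ‖f i t‖ ≤ K * |t| + ε i)
    (hadd : ∀ i s t, dist (f i (s + t)) (f i s * f i t) ≤ ε i) :
    ∃ φ : OneParameterSubgroup A, ‖φ‖ ≤ K ∧ ∀ t, Tendsto (f · t) 𝒰 (𝓝 (φ t)) := by
  have hlimit : ∀ t, ∃ y, Tendsto (f · t) 𝒰 (𝓝 y) := by
    intro t
    have hball : ∀ᶠ i in 𝒰, f i t ∈ Metric.closedBall 1 (K * |t| + 1) := by
      filter_upwards [hε.eventually (ge_mem_nhds one_pos)] with i hi
      rw [mem_closedBall_one_iff]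
      linarith [hf i t]
    obtain ⟨y, -, hy⟩ := (isCompact_closedBall _ _).ultrafilter_le_nhds' (𝒰.map (f · t)) hball
    exact ⟨y, hy⟩
  choose y hy using hlimit
  have hy_add : ∀ s t, y (s + t) = y s * y t := fun s t ↦ dist_eq_zero.1 <|
    tendsto_nhds_unique ((hy (s + t)).dist ((hy s).mul (hy t)))
      (squeeze_zero (fun _ ↦ dist_nonneg) (fun i ↦ hadd i s t) hε)
  have hy_norm : ∀ t, ‖y t‖ ≤ K * |t| := fun t ↦
    le_of_tendsto_of_tendsto' (hy t).norm' (by simpa using hε.const_add (K * |t|)) (hf · t)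
  obtain ⟨φ, hφ, hφy⟩ := exists_forall_apply_eq hK hy_add hy_norm
  exact ⟨φ, hφ, fun t ↦ (hφy t).symm ▸ hy t⟩

theorem exists_tendsto_pow_of_le [ProperSpace A] {𝒰 : Ultrafilter A} (h𝒰 : 𝒰 ≤ 𝓝 (1 : A))
    {κ : ℝ} (n : A → ℕ) (hn : ∀ z, n z * ‖z‖ ≤ κ) :
    ∃ φ : OneParameterSubgroup A, ‖φ‖ ≤ κ ∧ Tendsto (fun z ↦ z ^ n z) 𝒰 (𝓝 (φ 1)) := by
  have hκ : 0 ≤ κ := by simpa using hn 1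
  have hε : Tendsto (fun z : A ↦ ‖z‖) 𝒰 (𝓝 0) := by
    simpa using (continuous_norm'.tendsto (1 : A)).mono_left h𝒰
  have hnorm : ∀ (z : A) (t : ℝ), ‖z ^ ⌊t * n z⌋‖ ≤ κ * |t| + ‖z‖ := by
    intro z t
    have hfloor : |(⌊t * n z⌋ : ℝ)| ≤ |t| * n z + 1 := by
      have habs : |t * n z| = |t| * n z := by rw [abs_mul, Nat.abs_cast]
      rw [← habs, abs_le]
      constructor <;> linarith [Int.floor_le (t * n z), Int.lt_floor_add_one (t * n z),
        neg_abs_le (t * n z), le_abs_self (t * n z)]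
    calc ‖z ^ ⌊t * n z⌋‖ ≤ |(⌊t * n z⌋ : ℝ)| * ‖z‖ := by
          simpa only [Int.norm_eq_abs] using norm_zpow_le_mul_norm ⌊t * n z⌋ z
      _ ≤ (|t| * n z + 1) * ‖z‖ := by gcongr
      _ = n z * ‖z‖ * |t| + ‖z‖ := by ring
      _ ≤ κ * |t| + ‖z‖ := by gcongr; exact hn z
  have hadd : ∀ (z : A) (s t : ℝ),
      dist (z ^ ⌊(s + t) * n z⌋) (z ^ ⌊s * n z⌋ * z ^ ⌊t * n z⌋) ≤ ‖z‖ := by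
    intro z s t
    have hfloor : ‖⌊(s + t) * n z⌋ - (⌊s * n z⌋ + ⌊t * n z⌋)‖ ≤ 1 := by
      have hlower := Int.le_floor_add (s * n z) (t * n z)
      have hupper := Int.le_floor_add_floor (s * n z) (t * n z)
      rw [add_mul, Int.norm_eq_abs]
      exact_mod_cast abs_le.2 ⟨by omega, by omega⟩
    rw [← zpow_add, dist_eq_norm_div, div_eq_mul_inv, ← zpow_neg, ← zpow_add]
    exact (norm_zpow_le_mul_norm _ z).trans (mul_le_of_le_one_left (norm_nonneg' z) hfloor)
  obtain ⟨φ, hφ, hlim⟩ := exists_tendsto_of_approx 𝒰 hκ hε hnorm hadd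
  exact ⟨φ, hφ, by simpa using hlim 1⟩

theorem norm_div_inv_smul_apply_one_le {C δ κ : ℝ} (h : IsGleasonMetric A C δ)
    {φ : OneParameterSubgroup A} {z : A} {n : ℕ} (hn0 : n ≠ 0) (hκ : κ ≤ δ / 2) (hφ : ‖φ‖ ≤ κ)
    (hn : n * ‖z‖ ≤ κ) (hn' : κ ≤ 2 * (n * ‖z‖)) (hclose : C * ‖z ^ n / φ 1‖ ≤ κ / 4) :
    ‖z / ((n : ℝ)⁻¹ • φ) 1‖ ≤ ‖z‖ / 2 := by
  have hn_pos : (0 : ℝ) < n := mod_cast hn0.bot_lt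
  set w := z / ((n : ℝ)⁻¹ • φ) 1
  have hw_pow : w ^ n = z ^ n / φ 1 := by
    rw [div_pow, smul_apply, one_mul, ← zpow_natCast (φ _), ← map_intCast_mul, Int.cast_natCast,
      mul_inv_cancel₀ hn_pos.ne']
  have hψ : n * ‖((n : ℝ)⁻¹ • φ) 1‖ ≤ κ := by
    calc n * ‖((n : ℝ)⁻¹ • φ) 1‖ ≤ n * (‖φ‖ * |1 * (n : ℝ)⁻¹|) := by
          gcongr
          exact φ.norm_apply_le _
      _ = ‖φ‖ := by rw [one_mul, abs_of_pos (inv_pos.2 hn_pos)]; field_simp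
      _ ≤ κ := hφ
  have hw : n * ‖w‖ ≤ δ := by
    calc n * ‖w‖ ≤ n * (‖z‖ + ‖((n : ℝ)⁻¹ • φ) 1‖) := by gcongr; exact norm_div_le _ _
      _ ≤ δ := by linarith
  have hescape := h.escape w n hw
  rw [hw_pow] at hescape
  exact le_of_mul_le_mul_left (a := (n : ℝ)) (by linarith) hn_pos

theorem eventually_exists_norm_div_apply_one_le [ProperSpace A] {C δ : ℝ}
    (h : IsGleasonMetric A C δ) :
    ∀ᶠ z in 𝓝 (1 : A), ∃ φ : OneParameterSubgroup A, ‖φ‖ ≤ 2 * ‖z‖ ∧ ‖z / φ 1‖ ≤ ‖z‖ / 2 := by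
  have hδ := h.pos
  refine mem_iff_ultrafilter.2 fun 𝒰 h𝒰 ↦ ?_
  set κ := δ / 2
  have hκ : 0 < κ := by positivity
  -- Gleason's construction: the powers of `z` traverse, at scale `κ`, almost a one-parameter
  -- subgroup, and an error at scale `κ` descends to `z` by the escape property.
  let n : A → ℕ := fun z ↦ ⌊κ / ‖z‖⌋₊
  have hn : ∀ z, n z * ‖z‖ ≤ κ := fun z ↦ by
    rcases eq_or_ne z 1 with rfl | hz
    · simpa using hκ.le
    · exact (le_div_iff₀ (norm_pos_iff'.2 hz)).1 (Nat.floor_le (by positivity))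
  obtain ⟨φ, hφ, hlim⟩ := exists_tendsto_pow_of_le h𝒰 n hn
  have hclose : ∀ᶠ z in 𝒰, C * ‖z ^ n z / φ 1‖ < κ / 4 :=
    (by simpa using (tendsto_iff_norm_div_tendsto_zero.1 hlim).const_mul C :
      Tendsto (fun z ↦ C * ‖z ^ n z / φ 1‖) 𝒰 (𝓝 0)).eventually (gt_mem_nhds (by positivity))
  have hsmall : ∀ᶠ z : A in 𝒰, ‖z‖ < κ :=
    ((continuous_norm'.tendsto (1 : A)).mono_left h𝒰).eventually (gt_mem_nhds (by simpa using hκ))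
  filter_upwards [hclose, hsmall] with z hz_close hz_small
  rcases eq_or_ne z 1 with rfl | hz
  · exact ⟨0, by simp⟩
  have hz_pos : 0 < ‖z‖ := norm_pos_iff'.2 hz
  have hn_one : 1 ≤ n z :=
    Nat.le_floor (by rw [Nat.cast_one, le_div_iff₀ hz_pos]; linarith)
  have hn_cast : (1 : ℝ) ≤ n z := mod_cast hn_one
  have hκ_lt : κ < (n z + 1) * ‖z‖ := (div_lt_iff₀ hz_pos).1 (Nat.lt_floor_add_one _)
  have hκ_le : κ ≤ 2 * (n z * ‖z‖) := by nlinarith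
  refine ⟨(n z : ℝ)⁻¹ • φ, ?_,
    norm_div_inv_smul_apply_one_le h (by omega) le_rfl hφ (hn z) hκ_le hz_close.le⟩
  rw [norm_smul, norm_inv, Real.norm_natCast, inv_mul_le_iff₀ (by linarith)]
  linarith

theorem eventually_exists_apply_one_eq [ProperSpace A] {C δ : ℝ} (h : IsGleasonMetric A C δ) :
    ∀ᶠ z in 𝓝 (1 : A), ∃ φ : OneParameterSubgroup A, ‖φ‖ ≤ 4 * ‖z‖ ∧ φ 1 = z := by
  obtain ⟨ρ, hρ, happrox⟩ := Metric.eventually_nhds_iff_ball.1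
    (eventually_exists_norm_div_apply_one_le h)
  filter_upwards [Metric.ball_mem_nhds _ hρ] with z hz
  rw [mem_ball_one_iff] at hz
  have hiterate : ∀ k : ℕ, ∃ φ : OneParameterSubgroup A,
      ‖z / φ 1‖ ≤ ‖z‖ * (1 / 2) ^ k ∧ ‖φ‖ ≤ 4 * ‖z‖ * (1 - (1 / 2) ^ k) := by
    intro k
    induction k with
    | zero => exact ⟨0, by simp⟩
    | succ k ih =>
      obtain ⟨φ, hzφ, hφ⟩ := ih
      have hpow : (1 / 2 : ℝ) ^ k ≤ 1 := pow_le_one₀ (by norm_num) (by norm_num)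
      obtain ⟨ψ, hψ, hzψ⟩ := happrox (z / φ 1) <| mem_ball_one_iff.2 <|
        (hzφ.trans (mul_le_of_le_one_right (norm_nonneg' z) hpow)).trans_lt hz
      refine ⟨φ + ψ, ?_, (norm_add_le φ ψ).trans ?_⟩
      · rw [add_apply, div_mul_eq_div_div, pow_succ]
        linarith
      · rw [pow_succ]
        linarith
  choose Φ hzΦ hΦ using hiterate
  have hΦ_le : ∀ k, ‖Φ k‖ ≤ 4 * ‖z‖ := fun k ↦ (hΦ k).trans <|
    mul_le_of_le_one_right (by positivity) (by linarith [pow_pos (one_half_pos (α := ℝ)) k])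
  obtain ⟨φ, hφ, hlim⟩ := exists_tendsto_of_approx (hyperfilter ℕ) (f := fun k ↦ Φ k)
    (K := 4 * ‖z‖) (ε := 0) (by positivity) tendsto_const_nhds
    (fun k t ↦ by
      rw [Pi.zero_apply, add_zero]
      exact ((Φ k).norm_apply_le t).trans (by gcongr; exact hΦ_le k))
    (fun k s t ↦ by rw [(Φ k).map_add, dist_self, Pi.zero_apply])
  refine ⟨φ, hφ, tendsto_nhds_unique (hlim 1) ?_⟩
  have hgeometric : Tendsto (fun k ↦ ‖z‖ * (1 / 2 : ℝ) ^ k) atTop (𝓝 0) := by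
    simpa using (tendsto_pow_atTop_nhds_zero_of_lt_one (r := (1 / 2 : ℝ)) (by norm_num)
      (by norm_num)).const_mul ‖z‖
  refine Tendsto.mono_left ?_ Nat.hyperfilter_le_atTop
  exact tendsto_iff_dist_tendsto_zero.2 <| squeeze_zero (fun _ ↦ dist_nonneg)
    (fun k ↦ by rw [dist_comm, dist_eq_norm_div]; exact hzΦ k) hgeometric

variable (A) in
/-- The exponential map of an abelian group `A` with an invariant metric, which evaluates
one-parameter subgroups at time one. -/
def exp : OneParameterSubgroup A →+ Additive A where
  toFun φ := Additive.ofMul (φ 1)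
  map_zero' := rfl
  map_add' _ _ := rfl

theorem toMul_exp (φ : OneParameterSubgroup A) : (exp A φ).toMul = φ 1 := rfl

theorem norm_exp_le (φ : OneParameterSubgroup A) : ‖exp A φ‖ ≤ ‖φ‖ := by
  simpa [← toMul_exp] using φ.norm_apply_le 1

theorem continuous_exp : Continuous (exp A) :=
  AddMonoidHomClass.continuous_of_bound (exp A) 1 fun φ ↦ by simpa using norm_exp_le φ

theorem isOpenMap_exp [ProperSpace A] {C δ : ℝ} (h : IsGleasonMetric A C δ) :
    IsOpenMap (exp A) := by
  rw [IsTopologicalAddGroup.isOpenMap_iff_nhds_zero]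
  intro s hs
  obtain ⟨r, hr, hrs⟩ := Metric.mem_nhds_iff.1 (mem_map.1 hs)
  have hsmall : ∀ᶠ z in 𝓝 (1 : A), 4 * ‖z‖ < r :=
    (continuous_const.mul continuous_norm').tendsto (1 : A) |>.eventually
      (gt_mem_nhds (by simpa using hr))
  have hlocal : ∀ᶠ z in 𝓝 (1 : A), Additive.ofMul z ∈ s := by
    filter_upwards [hsmall, eventually_exists_apply_one_eq h] with z hz
    rintro ⟨φ, hφ, rfl⟩
    exact hrs (mem_ball_zero_iff.2 (hφ.trans_lt hz))
  exact continuous_toMul.continuousAt.eventually hlocal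

theorem isDiscrete_ker_exp {C δ : ℝ} (h : IsGleasonMetric A C δ) :
    IsDiscrete ((exp A).ker : Set (OneParameterSubgroup A)) := by
  refine isDiscrete_iff_forall_mem_exists_isOpen.2 fun φ hφ ↦
    ⟨Metric.ball φ δ, Metric.isOpen_ball, ?_⟩
  refine Subset.antisymm (fun ψ ⟨hψ, hψ_ker⟩ ↦ ?_)
    (singleton_subset_iff.2 ⟨Metric.mem_ball_self h.pos, hφ⟩)
  have hone : (ψ - φ) 1 = 1 := AddMonoidHom.mem_ker.1 (sub_mem hψ_ker hφ)
  have hnorm := norm_le_mul_norm_apply_one h (ψ - φ) (mem_ball_iff_norm.1 hψ).le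
  rw [hone, norm_one', mul_zero] at hnorm
  exact sub_eq_zero.1 (norm_le_zero_iff.1 hnorm)

theorem bijective_exp [ProperSpace A] [ContractibleSpace A] {C δ : ℝ}
    (h : IsGleasonMetric A C δ) : Function.Bijective (exp A) := by
  have hopen := isOpenMap_exp h
  have hsc : SimplyConnectedSpace (Additive A) := inferInstanceAs (SimplyConnectedSpace A)
  have hsurj : Function.Surjective (exp A) := by
    have hrange : IsOpen ((exp A).range : Set (Additive A)) := hopen.isOpen_range
    exact range_eq_univ.1 (IsClopen.eq_univ ⟨AddSubgroup.isClosed_of_isOpen _ hrange, hrange⟩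
      ⟨0, (exp A).range.zero_mem⟩)
  have hquotient : IsOpenQuotientMap (exp A) := ⟨hsurj, continuous_exp, hopen⟩
  have hcovering : IsCoveringMap (exp A) :=
    (hquotient.isQuotientMap.isAddQuotientCoveringMap_of_isDiscrete_ker_addMonoidHom
      (isDiscrete_ker_exp h)).isCoveringMap
  have : LocallyPathConnectedSpace (Additive A) :=
    hquotient.isQuotientMap.locallyPathConnectedSpace
  obtain ⟨log, ⟨hzero, hlift⟩, -⟩ := hcovering.existsUnique_continuousMap_lifts
    (ContinuousMap.id (Additive A)) 0 0 (exp A).map_zero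
  have hleft : log ∘ exp A = id := by
    refine hcovering.eq_of_comp_eq (log.continuous.comp continuous_exp) continuous_id ?_ 0 ?_
    · rw [← Function.comp_assoc, hlift]
      rfl
    · simpa using hzero
  exact ⟨(Function.leftInverse_iff_comp.2 hleft).injective, hsurj⟩

end OneParameterSubgroup

end OneParameterSubgroup

section LengthGroup

open scoped Pointwise in
theorem IsLengthGroup.properSpace {G : Type*} [SeminormedGroup G] [ContinuousMul G]
    [LocallyCompactSpace G] (hl : IsLengthGroup G) : ProperSpace G := by
  obtain ⟨K, hK, hK_nhds⟩ := exists_compact_mem_nhds (1 : G)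
  obtain ⟨ε, hε, hεK⟩ := Metric.mem_nhds_iff.1 hK_nhds
  have hcover : ∀ n : ℕ, ∃ L : Set G, IsCompact L ∧ Metric.ball 1 ((n + 1) * ε) ⊆ L := by
    intro n
    induction n with
    | zero => exact ⟨K, hK, by simpa using hεK⟩
    | succ n ih =>
      obtain ⟨L, hL, hnL⟩ := ih
      refine ⟨L * K, hL.mul hK, fun g hg ↦ ?_⟩
      obtain ⟨h, k, rfl, hh, hk⟩ := hl g ((n + 1) * ε) ε (by positivity) hε
        (by rw [mem_ball_one_iff] at hg; push_cast at hg; linarith)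
      exact mul_mem_mul (hnL (mem_ball_one_iff.2 hh)) (hεK (mem_ball_one_iff.2 hk))
  have hball : ∀ R, IsCompact (Metric.closedBall (1 : G) R) := by
    intro R
    obtain ⟨n, hn⟩ := exists_nat_gt (R / ε)
    rw [div_lt_iff₀ hε] at hn
    obtain ⟨L, hL, hnL⟩ := hcover n
    exact hL.closure.of_isClosed_subset Metric.isClosed_closedBall
      (((Metric.closedBall_subset_ball (by linarith)).trans hnL).trans subset_closure)
  refine ⟨fun x R ↦ ?_⟩
  have hx := (hball R).smul x
  rwa [Metric.smul_closedBall, smul_eq_mul, mul_one] at hx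

theorem IsLengthGroup.exists_norm_le_mul_norm {G V : Type*} [SeminormedGroup G]
    [SeminormedAddCommGroup V] [NormedSpace ℝ V] (hl : IsLengthGroup G) {f : G →* Multiplicative V}
    (hf : Continuous f) : ∃ L : ℝ, 1 ≤ L ∧ ∀ g, ‖f g‖ ≤ L * ‖g‖ := by
  obtain ⟨δ, hδ, hδf⟩ := Metric.continuousAt_iff.1 (hf.continuousAt (x := 1)) 1 one_pos
  simp only [map_one, dist_one_right] at hδf
  have hcoarse : ∀ g, ‖f g‖ ≤ ‖g‖ / δ + 1 := by
    intro g
    have hfloor := hl.le_nat_mul_of_subadditive (f := fun g ↦ ‖f g‖) (D := 1)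
      (fun x y ↦ by rw [map_mul]; exact norm_mul_le' _ _) hδ (fun x hx ↦ (hδf hx).le)
      ⌊‖g‖ / δ⌋₊ g ((div_lt_iff₀ hδ).1 (Nat.lt_floor_add_one _))
    rw [mul_one] at hfloor
    exact hfloor.trans (by gcongr; exact Nat.floor_le (by have := norm_nonneg' g; positivity))
  -- The additive error disappears on replacing `g` by its powers.
  have hpow : ∀ (g : G) (m : ℕ), m * (‖f g‖ - ‖g‖ / δ) ≤ 1 := by
    intro g m
    have hfm : ‖f (g ^ m)‖ = m * ‖f g‖ := by
      rw [map_pow, ← norm_toAdd, toAdd_pow, ← Nat.cast_smul_eq_nsmul ℝ, norm_smul,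
        Real.norm_natCast, norm_toAdd]
    have hgm : ‖g ^ m‖ / δ ≤ m * (‖g‖ / δ) := by
      rw [← mul_div_assoc]
      gcongr
      exact norm_pow_le_mul_norm
    linarith [hcoarse (g ^ m)]
  refine ⟨max 1 δ⁻¹, le_max_left _ _, fun g ↦ ?_⟩
  have hle : ‖f g‖ - ‖g‖ / δ ≤ 0 := by
    by_contra! hpos
    obtain ⟨m, hm⟩ := exists_nat_gt (1 / (‖f g‖ - ‖g‖ / δ))
    exact (hpow g m).not_gt ((div_lt_iff₀ hpos).1 hm)
  calc ‖f g‖ ≤ δ⁻¹ * ‖g‖ := by rw [inv_mul_eq_div]; linarith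
    _ ≤ max 1 δ⁻¹ * ‖g‖ := by have := norm_nonneg' g; gcongr; exact le_max_right _ _

end LengthGroup

theorem exists_continuous_projection {G : Type*} [Group G] [TopologicalSpace G]
    [IsTopologicalGroup G] [LocallyCompactSpace G] [SigmaCompactSpace G] {U A : Subgroup G}
    (hU : IsClosed (U : Set G)) (hA : IsClosed (A : Set G)) (hU_normal : U.Normal)
    (hUA : U.IsComplement' A) :
    ∃ pr : G →* A, Continuous pr ∧ (∀ a : A, pr a = a) ∧ pr.ker = U := by
  have : SigmaCompactSpace A := hA.isClosedEmbedding_subtypeVal.sigmaCompactSpace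
  let q := hUA.symm.QuotientMulEquiv
  have hq_open : IsOpenMap q.symm := by
    refine MonoidHom.isOpenMap_of_sigmaCompact q.symm.toMonoidHom q.symm.surjective ?_
    exact QuotientGroup.continuous_mk.comp continuous_subtype_val
  have hq : Continuous q := by
    refine continuous_def.2 fun s hs ↦ ?_
    rw [← MulEquiv.coe_toEquiv, ← Equiv.image_symm_eq_preimage]
    exact hq_open s hs
  refine ⟨q.toMonoidHom.comp (QuotientGroup.mk' U), hq.comp QuotientGroup.continuous_mk,
    fun a ↦ q.apply_symm_apply a, ?_⟩
  exact (MonoidHom.ker_mulEquiv_comp _ q).trans (QuotientGroup.ker_mk' U)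

section MetricSplitting

/-- A splitting `e : V → G` of a homomorphism `ℓ` from a metric group onto a normed space, with
metric control on both maps. -/
structure IsMetricSplitting {G V : Type*} [SeminormedGroup G] [SeminormedAddCommGroup V]
    (e : V → G) (ℓ : G → V) (L : ℝ) : Prop where
  one_le : 1 ≤ L
  map_add : ∀ v w, e (v + w) = e v * e w
  norm_le : ∀ v, ‖e v‖ ≤ ‖v‖
  log_exp : ∀ v, ℓ (e v) = v
  log_mul : ∀ g h, ℓ (g * h) = ℓ g + ℓ h
  norm_log_le : ∀ g, ‖ℓ g‖ ≤ L * ‖g‖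

namespace IsMetricSplitting

variable {G V : Type*} [SeminormedGroup G] [SeminormedAddCommGroup V] {e : V → G} {ℓ : G → V}
  {L : ℝ} (h : IsMetricSplitting e ℓ L)
include h

theorem log_one : ℓ 1 = 0 := by simpa using h.log_mul 1 1

theorem log_inv (g : G) : ℓ g⁻¹ = -ℓ g :=
  eq_neg_of_add_eq_zero_left (by rw [← h.log_mul, inv_mul_cancel, h.log_one])

theorem map_zero : e 0 = 1 := by simpa using h.map_add 0 0

theorem map_neg (v : V) : e (-v) = (e v)⁻¹ :=
  eq_inv_of_mul_eq_one_left (by rw [← h.map_add, neg_add_cancel, h.map_zero])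

theorem exp_nsmul (n : ℕ) (v : V) : e (n • v) = e v ^ n := by
  induction n with
  | zero => rw [zero_nsmul, pow_zero, h.map_zero]
  | succ n ih => rw [succ_nsmul, h.map_add, ih, pow_succ]

end IsMetricSplitting

theorem exists_isMetricSplitting {G A : Type*} [SeminormedGroup G] [NormedCommGroup A]
    [ProperSpace A] [ContractibleSpace A] (hl : IsLengthGroup G) {C δ : ℝ}
    (hA : IsGleasonMetric A C δ) {pr : G →* A} {ι : A →* G} (hpr : Continuous pr)
    (hι : ∀ a, ‖ι a‖ ≤ ‖a‖) (hprι : ∀ a, pr (ι a) = a) :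
    ∃ (e : OneParameterSubgroup A → G) (ℓ : G → OneParameterSubgroup A) (L : ℝ),
      IsMetricSplitting e ℓ L ∧ (∀ g, ℓ g = 0 ↔ pr g = 1) ∧ ∀ a, e (ℓ (ι a)) = ι a := by
  have hbij := OneParameterSubgroup.bijective_exp hA
  let Exp : OneParameterSubgroup A ≃+ Additive A := AddEquiv.ofBijective _ hbij
  have hExp : ∀ φ, (Exp φ).toMul = φ 1 := OneParameterSubgroup.toMul_exp
  have hcont : Continuous Exp.symm := ((Equiv.ofBijective _ hbij).toHomeomorphOfContinuousOpen
    OneParameterSubgroup.continuous_exp (OneParameterSubgroup.isOpenMap_exp hA)).symm.continuous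
  let log : G →* Multiplicative (OneParameterSubgroup A) :=
    (AddMonoidHom.toMultiplicativeRight Exp.symm.toAddMonoidHom).comp pr
  obtain ⟨L, hL, hlog⟩ := hl.exists_norm_le_mul_norm (f := log) (hcont.comp hpr)
  let ℓ : G → OneParameterSubgroup A := fun g ↦ (log g).toAdd
  have hℓ : ∀ g, ℓ g = Exp.symm (Additive.ofMul (pr g)) := fun _ ↦ rfl
  refine ⟨fun φ ↦ ι (φ 1), ℓ, L, ?_, fun g ↦ ?_, fun a ↦ ?_⟩
  · refine ⟨hL, fun v w ↦ ?_, fun v ↦ ?_, fun v ↦ ?_, fun g h ↦ ?_, hlog⟩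
    · rw [OneParameterSubgroup.add_apply, map_mul]
    · exact (hι _).trans (OneParameterSubgroup.norm_exp_le v)
    · rw [hℓ, hprι, AddEquiv.symm_apply_eq]
      exact congrArg Additive.ofMul (hExp v).symm
    · simp only [hℓ, map_mul, ofMul_mul, map_add]
  · rw [hℓ, map_eq_zero_iff _ Exp.symm.injective, ofMul_eq_zero]
  · simp only [← hExp, hℓ, hprι, AddEquiv.apply_symm_apply, toMul_ofMul]

end MetricSplitting

section Vacuum

theorem eq_one_of_isNilpotent_sub_one_of_pow_mem_isCompact {R : Type*} [Ring R] [Algebra ℝ R]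
    [TopologicalSpace R] [IsTopologicalRing R] [ContinuousSMul ℝ R] [T2Space R] {x : R}
    (hx : IsNilpotent (x - 1)) {K : Set R} (hK : IsCompact K) (hpow : ∀ j : ℕ, x ^ j ∈ K) :
    x = 1 := by
  set y := x - 1 with hy
  have hdrop : ∀ p : ℕ, y ^ (p + 2) = 0 → y ^ (p + 1) = 0 := by
    intro p hp
    have hlinear : ∀ j : ℕ, y ^ p * x ^ j = y ^ p + (j : ℝ) • y ^ (p + 1) := by
      intro j
      induction j with
      | zero => simp
      | succ j ih =>
        have hstep : y ^ (p + 1) * x = y ^ (p + 1) := by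
          rw [← sub_eq_zero, ← mul_sub_one, ← pow_succ, hp]
        have hx_eq : y ^ p * x = y ^ p + y ^ (p + 1) := by rw [pow_succ, ← mul_one_add]; simp [hy]
        rw [pow_succ, ← mul_assoc, ih, add_mul, smul_mul_assoc, hstep, hx_eq, Nat.cast_succ,
          add_smul, one_smul, add_right_comm, add_assoc]
    have hinv : Tendsto (fun j : ℕ ↦ (j : ℝ)⁻¹) atTop (𝓝 0) := tendsto_inv_atTop_nhds_zero_nat
    have hbounded : Tendsto (fun j : ℕ ↦ (j : ℝ)⁻¹ • (y ^ p * x ^ j)) atTop (𝓝 0) :=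
      ((hK.image (continuous_const_mul (y ^ p))).isVonNBounded ℝ).smul_tendsto_zero
        (Eventually.of_forall fun j ↦ mem_image_of_mem _ (hpow j)) hinv
    have hlimit : Tendsto (fun j : ℕ ↦ (j : ℝ)⁻¹ • (y ^ p * x ^ j)) atTop (𝓝 (y ^ (p + 1))) := by
      have hlim := (hinv.smul_const (y ^ p)).add_const (y ^ (p + 1))
      rw [zero_smul, zero_add] at hlim
      refine hlim.congr' ((eventually_ne_atTop 0).mono fun j hj ↦ ?_)
      beta_reduce
      rw [hlinear, smul_add, inv_smul_smul₀ (Nat.cast_ne_zero.2 hj)]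
    exact tendsto_nhds_unique hlimit hbounded
  obtain ⟨k, hk⟩ := hx
  have hzero : ∀ p : ℕ, y ^ (p + 1) = 0 → y = 0 := by
    intro p hp
    induction p with
    | zero => simpa using hp
    | succ p ih => exact ih (hdrop p hp)
  exact sub_eq_zero.1 (hzero k (by rw [pow_succ, hk, zero_mul]))

theorem isNilpotent_sub_one_of_isUpperTriangular {n R : Type*} [Fintype n] [DecidableEq n]
    [LinearOrder n] [CommRing R] {M : Matrix n n R} (hM : M.IsUpperTriangular)
    (hdiag : ∀ i, M i i = 1) : IsNilpotent (M - 1) := by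
  have hcharpoly := M.aeval_self_charpoly
  rw [Matrix.charpoly_of_isUpperTriangular M hM] at hcharpoly
  exact ⟨Fintype.card n, by simpa [hdiag] using hcharpoly⟩

theorem IsRealUnipotent.eq_one_of_pow_mem_isCompact {U : Type*} [Group U] [TopologicalSpace U]
    (hU : IsRealUnipotent U) {K : Set U} (hK : IsCompact K) {u : U} (hu : ∀ j : ℕ, u ^ j ∈ K) :
    u = 1 := by
  obtain ⟨n, ρ, hρ, htriangular⟩ := hU
  refine hρ.injective ((map_one ρ).symm ▸ ?_)
  refine eq_one_of_isNilpotent_sub_one_of_pow_mem_isCompact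
    (isNilpotent_sub_one_of_isUpperTriangular (htriangular u).1 (htriangular u).2)
    (hK.image hρ.continuous) fun j ↦ ?_
  rw [← map_pow]
  exact mem_image_of_mem ρ (hu j)

theorem IsRealUnipotent.exists_forall_pow_mem_imp {U : Type*} [Group U] [TopologicalSpace U]
    [ContinuousMul U] [T2Space U] (hU : IsRealUnipotent U) {K O : Set U} (hK : IsCompact K)
    (hO : O ∈ 𝓝 1) : ∃ m : ℕ, ∀ w, (∀ j ≤ m, w ^ j ∈ K) → w ∈ O := by
  let L : ℕ → Set U := fun m ↦ K ∩ ⋂ j ≤ m, (· ^ j) ⁻¹' K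
  have hL : ∀ m, IsCompact (L m) := fun m ↦ hK.inter_right <|
    isClosed_biInter fun j _ ↦ hK.isClosed.preimage (continuous_pow j)
  have hL_anti : Antitone L := fun m n hmn ↦
    inter_subset_inter_right K (biInter_subset_biInter_left fun j hj ↦ le_trans hj hmn)
  obtain ⟨m, hm⟩ := exists_subset_nhds_of_isCompact (U := O) hL_anti.directed_ge hL fun w hw ↦ by
    simp only [L, mem_iInter, mem_inter_iff, mem_preimage] at hw
    rwa [hU.eq_one_of_pow_mem_isCompact hK fun j ↦ (hw j).2 j le_rfl]
  exact ⟨m + 1, fun w hw ↦ hm ⟨by simpa using hw 1 (by omega),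
    mem_iInter₂.2 fun j hj ↦ hw j (Nat.le_succ_of_le hj)⟩⟩

theorem conj_iterate {G : Type*} [Group G] (a x : G) (n : ℕ) :
    (fun x ↦ a⁻¹ * x * a)^[n] x = (a ^ n)⁻¹ * x * a ^ n := by
  induction n with
  | zero => simp
  | succ n ih => rw [Function.iterate_succ_apply', ih, pow_succ]; group

theorem inv_mul_mul_pow {G : Type*} [Group G] (b x : G) (k : ℕ) :
    (b⁻¹ * x * b) ^ k = b⁻¹ * x ^ k * b := by
  simpa using conj_pow (i := k) (a := b⁻¹) (b := x)

theorem IsVacuumSubset.exists_conj_mem_of_mem_nhds_one {G : Type*} [Group G] [TopologicalSpace G]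
    [IsTopologicalGroup G] [T2Space G] {U : Subgroup G} (hU : IsRealUnipotent U) {a : G} {Ω : Set G}
    (hΩ : IsVacuumSubset U a Ω) {K : Set G} (hK : IsCompact K) (hKU : K ⊆ U) {O : Set G}
    (hO : O ∈ 𝓝 1) : ∃ n : ℕ, 0 < n ∧ ∀ u ∈ K, (a ^ n)⁻¹ * u * a ^ n ∈ O := by
  obtain ⟨hΩ_compact, hΩU, hvacuum⟩ := hΩ
  have hpreimage : IsCompact (((↑) : U → G) ⁻¹' Ω) :=
    Topology.IsInducing.subtypeVal.isCompact_preimage' hΩ_compact (by simpa using hΩU)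
  obtain ⟨m, hm⟩ := hU.exists_forall_pow_mem_imp hpreimage
    (continuous_subtype_val.continuousAt.preimage_mem_nhds (x := (1 : U)) hO)
  -- Contracting the powers of `K` into `Ω` makes the elements of `K` themselves small.
  obtain ⟨n, hn, hnΩ⟩ := hvacuum (⋃ j ∈ Iic (m + 1), (· ^ j) '' K)
    ((finite_Iic (m + 1)).isCompact_biUnion fun j _ ↦ hK.image (continuous_pow j))
    (iUnion₂_subset fun j _ ↦ image_subset_iff.2 fun u hu ↦ U.pow_mem (hKU hu) j)
  have hpow : ∀ u ∈ K, ∀ j ≤ m + 1, ((a ^ n)⁻¹ * u * a ^ n) ^ j ∈ Ω := fun u hu j hj ↦ by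
    rw [inv_mul_mul_pow, ← conj_iterate]
    exact hnΩ (mem_image_of_mem _ (mem_biUnion (mem_Iic.2 hj) (mem_image_of_mem _ hu)))
  refine ⟨n, hn, fun u hu ↦ ?_⟩
  have hone : (a ^ n)⁻¹ * u * a ^ n ∈ Ω := by simpa only [pow_one] using hpow u hu 1 (by omega)
  exact hm ⟨_, hΩU hone⟩ fun j hj ↦ hpow u hu j (by omega)

theorem IsVacuumSubset.exists_norm_conj_le_half {G : Type*} [NormedGroup G] [IsTopologicalGroup G]
    [ProperSpace G] {C δ : ℝ} (hG : IsGleasonMetric G C δ) {U : Subgroup G}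
    (hU_closed : IsClosed (U : Set G)) (hU : IsRealUnipotent U) {a : G} {Ω : Set G}
    (hΩ : IsVacuumSubset U a Ω) :
    ∃ n : ℕ, 0 < n ∧ ∀ u ∈ U, ‖u‖ ≤ δ → ‖(a ^ n)⁻¹ * u * a ^ n‖ ≤ ‖u‖ / 2 := by
  have hC := hG.one_le
  have hδ := hG.pos
  set ε : ℝ := δ / (4 * (C + 1)) with hε
  have hε_pos : 0 < ε := by positivity
  have hεC : 4 * ((C + 1) * ε) = δ := by rw [hε]; field_simp
  obtain ⟨n, hn, hsmall⟩ := hΩ.exists_conj_mem_of_mem_nhds_one hU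
    ((isCompact_closedBall 1 δ).inter_right hU_closed) inter_subset_right
    (Metric.closedBall_mem_nhds 1 hε_pos)
  refine ⟨n, hn, fun u hu huδ ↦ ?_⟩
  rcases eq_or_ne u 1 with rfl | hu1
  · simp
  have hu_pos : 0 < ‖u‖ := norm_pos_iff'.2 hu1
  -- The powers of `u` up to `δ / ‖u‖` stay in the `δ`-ball.
  set M := ⌊δ / ‖u‖⌋₊
  have hM_one : (1 : ℝ) ≤ M := mod_cast Nat.le_floor (by
    rwa [Nat.cast_one, le_div_iff₀ hu_pos, one_mul])
  have hM_le : M * ‖u‖ ≤ δ := (le_div_iff₀ hu_pos).1 (Nat.floor_le (by positivity))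
  have hM_lt : δ < (M + 1) * ‖u‖ := (div_lt_iff₀ hu_pos).1 (Nat.lt_floor_add_one _)
  have hconj : M * ‖(a ^ n)⁻¹ * u * a ^ n‖ ≤ C * ε := by
    refine hG.mul_norm_le_of_norm_pow_le (by nlinarith) _ M fun k hk ↦ ?_
    rw [inv_mul_mul_pow]
    refine mem_closedBall_one_iff.1 (hsmall _ ⟨mem_closedBall_one_iff.2 ?_, U.pow_mem hu k⟩)
    calc ‖u ^ k‖ ≤ k * ‖u‖ := norm_pow_le_mul_norm
      _ ≤ M * ‖u‖ := by gcongr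
      _ ≤ δ := hM_le
  refine le_of_mul_le_mul_left (a := (M : ℝ)) ?_ (by linarith)
  nlinarith

end Vacuum

section ConjExp

/-- Conjugation `u ↦ (e v)⁻¹ * u * e v` by the image of a vector `v`, as an endomorphism. For
fixed `a`, the maps `conjExp e (s • a)` form the flow used to contract the kernel of a splitting. -/
def conjExp {G V : Type*} [Group G] (e : V → G) (v : V) : G →* G :=
  (MulAut.conj (e v)⁻¹).toMonoidHom

theorem conjExp_apply {G V : Type*} [Group G] (e : V → G) (v : V) (u : G) :
    conjExp e v u = (e v)⁻¹ * u * e v := by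
  simp [conjExp]

/-- The component in the kernel of `ℓ` of an element `g` of a group split by `e` and `ℓ`, defined
by `g = e (ℓ g) * kerPart e ℓ g`. -/
def kerPart {G V : Type*} [Group G] (e : V → G) (ℓ : G → V) (g : G) : G := (e (ℓ g))⁻¹ * g

namespace IsMetricSplitting

variable {G V : Type*} [SeminormedGroup G] [SeminormedAddCommGroup V] {e : V → G} {ℓ : G → V}
  {L : ℝ} (h : IsMetricSplitting e ℓ L)
include h

theorem conjExp_zero (u : G) : conjExp e 0 u = u := by simp [conjExp_apply, h.map_zero]

theorem conjExp_add (v w : V) (u : G) : conjExp e (v + w) u = conjExp e w (conjExp e v u) := by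
  simp only [conjExp_apply, h.map_add]
  group

theorem conjExp_comm (v w : V) (u : G) :
    conjExp e w (conjExp e v u) = conjExp e v (conjExp e w u) := by
  rw [← h.conjExp_add, ← h.conjExp_add, add_comm]

theorem conjExp_exp (v w : V) : conjExp e v (e w) = e w := by
  rw [conjExp_apply, ← h.map_neg, ← h.map_add, ← h.map_add, neg_add_cancel_comm]

theorem log_conjExp (v : V) (u : G) : ℓ (conjExp e v u) = ℓ u := by
  rw [conjExp_apply, h.log_mul, h.log_mul, h.log_inv, neg_add_cancel_comm]

theorem log_kerPart (g : G) : ℓ (kerPart e ℓ g) = 0 := by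
  rw [kerPart, h.log_mul, h.log_inv, h.log_exp, neg_add_cancel]

theorem kerPart_of_log_eq_zero {g : G} (hg : ℓ g = 0) : kerPart e ℓ g = g := by
  rw [kerPart, hg, h.map_zero, inv_one, one_mul]

theorem kerPart_mul (g k : G) :
    kerPart e ℓ (g * k) = conjExp e (ℓ k) (kerPart e ℓ g) * kerPart e ℓ k := by
  simp only [kerPart, conjExp_apply, h.log_mul, h.map_add]
  group

theorem norm_kerPart_le (g : G) : ‖kerPart e ℓ g‖ ≤ (L + 1) * ‖g‖ := by
  have hmul : ‖kerPart e ℓ g‖ ≤ ‖e (ℓ g)‖ + ‖g‖ :=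
    (norm_mul_le' (e (ℓ g))⁻¹ g).trans_eq (by rw [norm_inv'])
  linarith [h.norm_le (ℓ g), h.norm_log_le g]

theorem norm_conjExp_nsmul_le {C δ : ℝ} (hG : IsGleasonMetric G C δ) {v : V} {u : G}
    (hv : ‖v‖ ≤ δ) (n : ℕ) (hu : Real.exp (C * (n * ‖v‖)) * ‖u‖ ≤ δ) :
    ‖conjExp e (n • v) u‖ ≤ Real.exp (C * (n * ‖v‖)) * ‖u‖ := by
  have hC := hG.one_le
  induction n with
  | zero => simp [h.conjExp_zero]
  | succ n ih =>
    have hle : Real.exp (C * (n * ‖v‖)) * ‖u‖ ≤ δ := by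
      refine le_trans ?_ hu
      gcongr
      exact n.le_succ
    have hstep := hG.norm_conj_le ((h.norm_le v).trans hv) ((ih hle).trans hle)
    have hexp : 1 + C * ‖e v‖ ≤ Real.exp (C * ‖v‖) := by
      have := mul_le_mul_of_nonneg_left (h.norm_le v) (show 0 ≤ C by linarith)
      linarith [Real.add_one_le_exp (C * ‖v‖)]
    rw [succ_nsmul, h.conjExp_add, conjExp_apply]
    calc _ ≤ _ := hstep
      _ ≤ Real.exp (C * ‖v‖) * (Real.exp (C * (n * ‖v‖)) * ‖u‖) :=
        mul_le_mul hexp (ih hle) (norm_nonneg' _) (Real.exp_nonneg _)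
      _ = Real.exp (C * ((n + 1 : ℕ) * ‖v‖)) * ‖u‖ := by
        rw [← mul_assoc, ← Real.exp_add]
        congr 2
        push_cast
        ring

theorem norm_conjExp_le [NormedSpace ℝ V] {C δ : ℝ} (hG : IsGleasonMetric G C δ) (v : V) {u : G}
    (hu : Real.exp (C * ‖v‖) * ‖u‖ ≤ δ) :
    ‖conjExp e v u‖ ≤ Real.exp (C * ‖v‖) * ‖u‖ := by
  have hδ := hG.pos
  obtain ⟨m, hm⟩ := exists_nat_gt (‖v‖ / δ)
  have hm0 : (0 : ℝ) < m := lt_of_le_of_lt (by positivity) hm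
  have hnorm : m * ‖(m : ℝ)⁻¹ • v‖ = ‖v‖ := by
    rw [norm_smul, norm_inv, Real.norm_natCast, mul_inv_cancel_left₀ hm0.ne']
  have hsmall : ‖(m : ℝ)⁻¹ • v‖ ≤ δ := by
    rw [div_lt_iff₀ hδ] at hm
    exact le_of_mul_le_mul_left (hnorm.trans_le hm.le) hm0
  have hpow := h.norm_conjExp_nsmul_le hG (u := u) hsmall m
  rw [hnorm, ← Nat.cast_smul_eq_nsmul ℝ, smul_inv_smul₀ hm0.ne'] at hpow
  exact hpow hu

theorem dist_conjExp_le {C δ : ℝ} (hG : IsGleasonMetric G C δ) {v : V} {w : G} {m : ℝ}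
    (hw : ‖w‖ ≤ m) (hvw : ‖conjExp e v w‖ ≤ m) (hm : m ≤ δ) :
    dist w (conjExp e v w) ≤ (C + 2 / δ) * ‖v‖ * m := by
  have hC := hG.one_le
  have hδ := hG.pos
  have hm0 : 0 ≤ m := (norm_nonneg' w).trans hw
  rcases le_total ‖v‖ δ with hv | hv
  · have hcomm : dist w (conjExp e v w) = dist (e v * w) (w * e v) := by
      rw [conjExp_apply, ← dist_mul_left (e v)]
      group
    calc dist w (conjExp e v w) ≤ C * ‖e v‖ * ‖w‖ :=
          hcomm.trans_le (hG.commutator _ _ ((h.norm_le v).trans hv) (hw.trans hm))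
      _ ≤ C * ‖v‖ * m := by
          gcongr
          exact h.norm_le v
      _ ≤ (C + 2 / δ) * ‖v‖ * m := by
          gcongr
          exact le_add_of_nonneg_right (by positivity)
  · calc dist w (conjExp e v w) ≤ ‖w‖ + ‖conjExp e v w‖ := dist_le_norm_add_norm' _ _
      _ ≤ 2 / δ * δ * m := by rw [div_mul_cancel₀ _ hδ.ne']; linarith
      _ ≤ (C + 2 / δ) * ‖v‖ * m := by
          gcongr
          exact le_add_of_nonneg_left (by positivity)

theorem norm_conjExp_nsmul_le_of_le_half {δ : ℝ} {b : V}
    (hhalf : ∀ u, ℓ u = 0 → ‖u‖ ≤ δ → ‖conjExp e b u‖ ≤ ‖u‖ / 2) {u : G} (hu : ℓ u = 0)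
    (huδ : ‖u‖ ≤ δ) (n : ℕ) : ‖conjExp e (n • b) u‖ ≤ (1 / 2) ^ n * ‖u‖ := by
  induction n with
  | zero => simp [h.conjExp_zero]
  | succ n ih =>
    have hle : (1 / 2 : ℝ) ^ n * ‖u‖ ≤ ‖u‖ := mul_le_of_le_one_left (norm_nonneg' u)
      (pow_le_one₀ (by norm_num) (by norm_num))
    have hstep := hhalf _ ((h.log_conjExp (n • b) u).trans hu) ((ih.trans hle).trans huδ)
    rw [succ_nsmul, h.conjExp_add, pow_succ]
    linarith

end IsMetricSplitting

theorem IsGleasonMetric.norm_conj_le_mul {G : Type*} [SeminormedGroup G] {C δ : ℝ}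
    (hG : IsGleasonMetric G C δ) (hl : IsLengthGroup G) {w : G} (hw : ‖w‖ ≤ δ) (x : G) :
    ‖w⁻¹ * x * w‖ ≤ (1 + C * δ) * ‖x‖ := by
  have hC := hG.one_le
  have hδ := hG.pos
  refine hl.le_mul_norm_of_subadditive (f := fun x ↦ ‖w⁻¹ * x * w‖) (ε := δ) (fun x y ↦ ?_)
    (by positivity) hδ (fun x hx ↦ (hG.norm_conj_le hw hx.le).trans ?_) x
  · have hconj : w⁻¹ * (x * y) * w = w⁻¹ * x * w * (w⁻¹ * y * w) := by group
    rw [hconj]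
    exact norm_mul_le' _ _
  · have := norm_nonneg' x
    gcongr

theorem IsMetricSplitting.dist_exp_mul_le {G V : Type*} [SeminormedGroup G]
    [SeminormedAddCommGroup V] {e : V → G} {ℓ : G → V} {L C δ : ℝ} (h : IsMetricSplitting e ℓ L)
    (hG : IsGleasonMetric G C δ) (hl : IsLengthGroup G) {w : G} (hw : ‖w‖ ≤ δ) (x y : V) :
    dist (e x * w) (e y * w) ≤ (1 + C * δ) * ‖x - y‖ := by
  have hC := hG.one_le
  have hδ := hG.pos
  have hdiff : (e x * w)⁻¹ * (e y * w) = w⁻¹ * e (-x + y) * w := by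
    rw [h.map_add, h.map_neg]
    group
  rw [dist_eq_norm_inv_mul, hdiff, norm_sub_rev, ← neg_add_eq_sub]
  refine (hG.norm_conj_le_mul hl hw _).trans ?_
  gcongr
  exact h.norm_le _

end ConjExp

theorem one_half_pow_floor_div_log_two_le (s : ℝ) :
    (1 / 2 : ℝ) ^ ⌊s / Real.log 2⌋₊ ≤ 2 * Real.exp (-s) := by
  set n := ⌊s / Real.log 2⌋₊
  have hs : s ≤ (n + 1) * Real.log 2 :=
    ((div_lt_iff₀ (Real.log_pos one_lt_two)).1 (Nat.lt_floor_add_one _)).le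
  calc (1 / 2 : ℝ) ^ n = 2 * Real.exp (-((n + 1 : ℕ) * Real.log 2)) := by
        rw [Real.exp_neg, Real.exp_nat_mul, Real.exp_log two_pos, pow_succ, one_div, inv_pow]
        field_simp
    _ ≤ 2 * Real.exp (-s) := by gcongr; exact_mod_cast hs

theorem exp_mul_exp_neg_mul_succ_le_one {A D ε r s x : ℝ} {n : ℕ} (hD : 0 ≤ D) (hr : 0 < r)
    (hn : n ≤ x / ε) (hx : r ≤ x) (hs : (A + 1 / ε + D / r) * x ≤ s) :
    Real.exp (A * x) * (D * Real.exp (-s)) * (n + 1) ≤ 1 := by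
  have hn_exp : (n : ℝ) + 1 ≤ Real.exp (x / ε) :=
    (Real.add_one_le_exp (n : ℝ)).trans (Real.exp_le_exp.2 hn)
  have hD_exp : D ≤ Real.exp (D / r * x) := by
    have : D ≤ D / r * x := by rw [div_mul_eq_mul_div, le_div_iff₀ hr]; gcongr
    linarith [Real.add_one_le_exp (D / r * x)]
  calc Real.exp (A * x) * (D * Real.exp (-s)) * (n + 1)
      ≤ Real.exp (A * x) * (Real.exp (D / r * x) * Real.exp (-s)) * Real.exp (x / ε) := by gcongr
    _ = Real.exp ((A + 1 / ε + D / r) * x - s) := by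
        rw [← Real.exp_add, ← Real.exp_add, ← Real.exp_add]
        congr 1
        ring
    _ ≤ 1 := Real.exp_le_one_iff.2 (by linarith)

section ContractingFlow

/-- The flow `s ↦ conjExp e (s • a)` contracts the kernel of `ℓ` near the identity exponentially
fast. The rate is normalized to `1` by the choice of `a`. -/
structure IsContractingFlow {G V : Type*} [SeminormedGroup G] [AddCommGroup V] [Module ℝ V]
    (e : V → G) (ℓ : G → V) (a : V) (B η : ℝ) : Prop where
  one_le : 1 ≤ B
  pos : 0 < η
  norm_le : ∀ u, ℓ u = 0 → ‖u‖ ≤ η → ∀ s, 0 ≤ s →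
    ‖conjExp e (s • a) u‖ ≤ B * Real.exp (-s) * ‖u‖

variable {G V : Type*} [SeminormedGroup G] [SeminormedAddCommGroup V] [NormedSpace ℝ V]
  {e : V → G} {ℓ : G → V} {L C δ : ℝ}

theorem IsMetricSplitting.exists_isContractingFlow (h : IsMetricSplitting e ℓ L)
    (hG : IsGleasonMetric G C δ) {b : V}
    (hhalf : ∀ u, ℓ u = 0 → ‖u‖ ≤ δ → ‖conjExp e b u‖ ≤ ‖u‖ / 2) :
    ∃ a B η, IsContractingFlow e ℓ a B η := by
  have hC := hG.one_le
  have hδ := hG.pos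
  set E := Real.exp (C * ‖b‖)
  have hE : 1 ≤ E := Real.one_le_exp (by positivity)
  refine ⟨(Real.log 2)⁻¹ • b, 2 * E, δ / E, by linarith, by positivity, fun u hu huη s hs ↦ ?_⟩
  have hu0 := norm_nonneg' u
  rw [le_div_iff₀ (by positivity)] at huη
  set n := ⌊s / Real.log 2⌋₊
  set t := s / Real.log 2 - n
  have ht0 : 0 ≤ t := sub_nonneg.2 (Nat.floor_le (by positivity))
  have ht1 : t < 1 := by linarith [Nat.lt_floor_add_one (s / Real.log 2)]
  have hsplit : s • (Real.log 2)⁻¹ • b = n • b + t • b := by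
    rw [← Nat.cast_smul_eq_nsmul ℝ, ← add_smul, add_sub_cancel, smul_smul, div_eq_mul_inv]
  have htE : Real.exp (C * ‖t • b‖) ≤ E := by
    have : ‖t • b‖ ≤ ‖b‖ := by
      rw [norm_smul, Real.norm_of_nonneg ht0]
      exact mul_le_of_le_one_left (norm_nonneg b) ht1.le
    exact Real.exp_le_exp.2 (by gcongr)
  have hn := h.norm_conjExp_nsmul_le_of_le_half hhalf hu (by nlinarith : ‖u‖ ≤ δ) n
  have hpow := one_half_pow_floor_div_log_two_le s
  have hEn := mul_le_mul htE hn (norm_nonneg' _) (Real.exp_nonneg _ |>.trans htE)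
  have hsmall : E * ((1 / 2) ^ n * ‖u‖) ≤ E * ‖u‖ := by
    gcongr
    exact mul_le_of_le_one_left hu0 (pow_le_one₀ (by norm_num) (by norm_num))
  rw [hsplit, h.conjExp_add]
  calc _ ≤ _ := h.norm_conjExp_le hG _ (by linarith)
    _ ≤ _ := hEn
    _ ≤ E * (2 * Real.exp (-s) * ‖u‖) := by gcongr
    _ = _ := by ring

namespace IsContractingFlow

variable {a : V} {B η : ℝ} (hf : IsContractingFlow e ℓ a B η)
include hf

theorem norm_conjExp_le_mul_norm {u : G} (hu : ℓ u = 0) (huη : ‖u‖ ≤ η) {s : ℝ} (hs : 0 ≤ s) :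
    ‖conjExp e (s • a) u‖ ≤ B * ‖u‖ := by
  have hB := hf.one_le
  refine (hf.norm_le u hu huη s hs).trans ?_
  gcongr
  exact mul_le_of_le_one_right (by positivity) (Real.exp_le_one_iff.2 (by linarith))

theorem exists_norm_conjExp_le_mul_norm (h : IsMetricSplitting e ℓ L) (hl : IsLengthGroup G) :
    ∃ R : ℝ, 0 ≤ R ∧ ∀ s : ℝ, 0 ≤ s → ∀ g, ‖conjExp e (s • a) g‖ ≤ R * ‖g‖ := by
  have hL := h.one_le
  have hB := hf.one_le
  have hη := hf.pos
  refine ⟨L + B * (L + 1), by positivity, fun s hs ↦ hl.le_mul_norm_of_subadditive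
    (ε := η / (L + 1)) (fun x y ↦ ?_) (by positivity) (by positivity) fun g hg ↦ ?_⟩
  · rw [map_mul]
    exact norm_mul_le' _ _
  rw [lt_div_iff₀' (by positivity)] at hg
  have hker := h.norm_kerPart_le g
  have hexp : ‖e (ℓ g)‖ ≤ L * ‖g‖ := (h.norm_le _).trans (h.norm_log_le g)
  have hg_eq : conjExp e (s • a) g = e (ℓ g) * conjExp e (s • a) (kerPart e ℓ g) := by
    rw [← h.conjExp_exp (s • a) (ℓ g), ← map_mul, kerPart, mul_inv_cancel_left]
  calc ‖conjExp e (s • a) g‖ ≤ ‖e (ℓ g)‖ + ‖conjExp e (s • a) (kerPart e ℓ g)‖ :=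
        hg_eq ▸ norm_mul_le' _ _
    _ ≤ L * ‖g‖ + B * ((L + 1) * ‖g‖) := by
        have hflow := hf.norm_conjExp_le_mul_norm (h.log_kerPart g) (hker.trans hg.le) hs
        refine add_le_add hexp (hflow.trans ?_)
        gcongr
    _ = (L + B * (L + 1)) * ‖g‖ := by ring

variable (h : IsMetricSplitting e ℓ L) (hG : IsGleasonMetric G C δ)
include h hG

theorem norm_conjExp_kerPart_le (hl : IsLengthGroup G) {s κ ε R : ℝ} (hs : 0 ≤ s) (hε : 0 < ε)
    (hεη : (L + 1) * ε ≤ η) (hκδ : κ ≤ δ)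
    (hκ : Real.exp (C * (L * R)) * (B * Real.exp (-s) * η) ≤ κ) (n : ℕ) (hn : n * ε ≤ R) (g : G)
    (hg : ‖g‖ < (n + 1) * ε) : ‖conjExp e (s • a) (kerPart e ℓ g)‖ ≤ (n + 1) * κ := by
  have hC := hG.one_le
  have hL := h.one_le
  have hB := hf.one_le
  have hstep : ∀ x y, ‖x‖ ≤ R → ‖y‖ < ε →
      ‖conjExp e (ℓ x) (conjExp e (s • a) (kerPart e ℓ y))‖ ≤ κ := by
    intro x y hx hy
    have hyη : ‖kerPart e ℓ y‖ ≤ η := (h.norm_kerPart_le y).trans (le_trans (by gcongr) hεη)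
    have hflow : ‖conjExp e (s • a) (kerPart e ℓ y)‖ ≤ B * Real.exp (-s) * η :=
      (hf.norm_le _ (h.log_kerPart y) hyη s hs).trans (by gcongr)
    have hexp : Real.exp (C * ‖ℓ x‖) ≤ Real.exp (C * (L * R)) := by
      have := (h.norm_log_le x).trans (show L * ‖x‖ ≤ L * R by gcongr)
      gcongr
    have hprod := (mul_le_mul hexp hflow (norm_nonneg' _) (Real.exp_nonneg _)).trans hκ
    exact (h.norm_conjExp_le hG _ (hprod.trans hκδ)).trans hprod
  induction n generalizing g with
  | zero =>
    have := hstep 1 g (by simpa using hn) (by simpa using hg)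
    simpa [h.log_one, h.conjExp_zero] using this
  | succ n ih =>
    push_cast at hn hg ⊢
    obtain ⟨y, x, rfl, hy, hx⟩ := hl g ε ((n + 1) * ε) hε (by positivity) (by linarith)
    rw [h.kerPart_mul, map_mul, h.conjExp_comm]
    refine (norm_mul_le' _ _).trans ?_
    linarith [hstep x y (hx.le.trans hn) hy, ih (by linarith) x hx]

/-- The time needed to bring an element of the kernel close to the identity is linear in its norm,
although a priori the contraction is only known near the identity. -/
theorem exists_norm_conjExp_le (hl : IsLengthGroup G) {θ : ℝ} (hθ : 0 < θ) :
    ∃ S : ℝ, 0 < S ∧ ∀ u, ℓ u = 0 → ∀ s, S * ‖u‖ ≤ s → ‖conjExp e (s • a) u‖ ≤ θ := by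
  have hC := hG.one_le
  have hδ := hG.pos
  have hL := h.one_le
  have hB := hf.one_le
  have hη := hf.pos
  set ε := η / (L + 1)
  have hε : 0 < ε := by positivity
  set κ := min θ δ
  have hκ : 0 < κ := lt_min hθ hδ
  set r := min η (θ / B)
  have hr : 0 < r := by positivity
  set D := B * η / κ
  have hD : 0 < D := by positivity
  refine ⟨C * L + 1 / ε + D / r, by positivity, fun u hu s hs ↦ ?_⟩
  have hs0 : 0 ≤ s := le_trans (by positivity) hs
  rcases le_total ‖u‖ r with hur | hur
  · refine (hf.norm_conjExp_le_mul_norm hu (hur.trans (min_le_left _ _)) hs0).trans ?_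
    exact (le_div_iff₀' (by positivity)).1 (hur.trans (min_le_right _ _))
  set n := ⌊‖u‖ / ε⌋₊
  have hn0 : (0 : ℝ) < n + 1 := by positivity
  have hn : n ≤ ‖u‖ / ε := Nat.floor_le (by positivity)
  have hbound : Real.exp (C * (L * ‖u‖)) * (B * Real.exp (-s) * η) ≤ κ / (n + 1) := by
    rw [le_div_iff₀ hn0]
    have hone := exp_mul_exp_neg_mul_succ_le_one hD.le hr hn hur hs
    calc Real.exp (C * (L * ‖u‖)) * (B * Real.exp (-s) * η) * (n + 1)
        = Real.exp (C * L * ‖u‖) * (B * η / κ * Real.exp (-s)) * (n + 1) * κ := by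
          field_simp
      _ ≤ κ := mul_le_of_le_one_left hκ.le hone
  have hsum := hf.norm_conjExp_kerPart_le h hG hl hs0 hε (mul_div_cancel₀ _ (by positivity)).le
    ((div_le_self hκ.le (by simp)).trans (min_le_right _ _)) hbound n ((le_div_iff₀ hε).1 hn) u
    ((div_lt_iff₀ hε).1 (Nat.lt_floor_add_one _))
  rw [h.kerPart_of_log_eq_zero hu, mul_div_cancel₀ _ hn0.ne'] at hsum
  exact hsum.trans (min_le_left _ _)

end IsContractingFlow

end ContractingFlow

section LogFlow

/-- The flow `s ↦ conjExp e (s • a)` at time `s = -log σ`, extended to `σ = 0` by the trivial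
homomorphism. For a contracting flow it cones the kernel off to the identity, `σ` being the radial
coordinate. -/
noncomputable def logFlow {G V : Type*} [Group G] [AddCommGroup V] [Module ℝ V] (e : V → G) (a : V)
    (σ : ℝ) : G →* G :=
  if 0 < σ then conjExp e ((-Real.log σ) • a) else 1

theorem logFlow_of_pos {G V : Type*} [Group G] [AddCommGroup V] [Module ℝ V] (e : V → G) (a : V)
    {σ : ℝ} (hσ : 0 < σ) : logFlow e a σ = conjExp e ((-Real.log σ) • a) :=
  if_pos hσ

theorem logFlow_zero {G V : Type*} [Group G] [AddCommGroup V] [Module ℝ V] (e : V → G) (a : V) :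
    logFlow e a 0 = 1 :=
  if_neg (lt_irrefl 0)

variable {G V : Type*} [SeminormedGroup G] [SeminormedAddCommGroup V] [NormedSpace ℝ V]
  {e : V → G} {ℓ : G → V} {L C δ : ℝ}

theorem IsContractingFlow.norm_logFlow_le {a : V} {B η : ℝ} (hf : IsContractingFlow e ℓ a B η)
    {u : G} (hu : ℓ u = 0) (huη : ‖u‖ ≤ η) {σ : ℝ} (hσ : 0 ≤ σ) (hσ1 : σ ≤ 1) :
    ‖logFlow e a σ u‖ ≤ B * σ * ‖u‖ := by
  rcases hσ.eq_or_lt with rfl | hσ0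
  · simp [logFlow_zero]
  · simpa only [logFlow_of_pos e a hσ0, neg_neg, Real.exp_log hσ0] using
      hf.norm_le u hu huη (-Real.log σ) (neg_nonneg.2 (Real.log_nonpos hσ hσ1))

theorem IsMetricSplitting.logFlow_one (h : IsMetricSplitting e ℓ L) (a : V) (u : G) :
    logFlow e a 1 u = u := by
  rw [logFlow_of_pos e a one_pos, Real.log_one, neg_zero, zero_smul, h.conjExp_zero]

theorem IsMetricSplitting.logFlow_eq_conjExp (h : IsMetricSplitting e ℓ L) (a : V) {σ σ' : ℝ}
    (hσ' : 0 < σ') (hσ : 0 < σ) (u : G) :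
    logFlow e a σ' u = conjExp e ((Real.log σ - Real.log σ') • a) (logFlow e a σ u) := by
  rw [logFlow_of_pos e a hσ, logFlow_of_pos e a hσ', ← h.conjExp_add, ← add_smul]
  ring_nf

theorem log_sub_log_le_of_half_le {σ σ' : ℝ} (hσ : 0 < σ) (hle : σ' ≤ σ) (hhalf : σ / 2 ≤ σ') :
    Real.log σ - Real.log σ' ≤ 2 / σ * (σ - σ') := by
  have hσ' : 0 < σ' := by linarith
  calc Real.log σ - Real.log σ' ≤ σ / σ' - 1 := by
        rw [← Real.log_div hσ.ne' hσ'.ne']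
        exact Real.log_le_sub_one_of_pos (by positivity)
    _ = (σ - σ') / σ' := by rw [sub_div, div_self hσ'.ne']
    _ ≤ (σ - σ') / (σ / 2) := by gcongr
    _ = 2 / σ * (σ - σ') := by ring

theorem IsContractingFlow.exists_dist_logFlow_le {a : V} {B η : ℝ}
    (hf : IsContractingFlow e ℓ a B η) (h : IsMetricSplitting e ℓ L)
    (hG : IsGleasonMetric G C δ) :
    ∃ D : ℝ, 0 ≤ D ∧ ∀ u, ℓ u = 0 → ‖u‖ ≤ η → B * ‖u‖ ≤ δ → ∀ σ σ', 0 ≤ σ' → σ' ≤ σ → σ ≤ 1 →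
      dist (logFlow e a σ u) (logFlow e a σ' u) ≤ D * ‖u‖ * (σ - σ') := by
  have hC := hG.one_le
  have hδ := hG.pos
  have hB := hf.one_le
  refine ⟨4 * B + 2 * B * (C + 2 / δ) * ‖a‖, by positivity,
    fun u hu huη huδ σ σ' hσ' hle hσ1 ↦ ?_⟩
  have hσn := hf.norm_logFlow_le hu huη (hσ'.trans hle) hσ1
  have hσn' : ‖logFlow e a σ' u‖ ≤ B * σ * ‖u‖ :=
    (hf.norm_logFlow_le hu huη hσ' (hle.trans hσ1)).trans (by gcongr)
  rcases le_total σ' (σ / 2) with hhalf | hhalf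
  · calc dist (logFlow e a σ u) (logFlow e a σ' u)
        ≤ ‖logFlow e a σ u‖ + ‖logFlow e a σ' u‖ := dist_le_norm_add_norm' _ _
      _ ≤ 2 * B * ‖u‖ * σ := by linarith
      _ ≤ 2 * B * ‖u‖ * (2 * (σ - σ')) := by gcongr; linarith
      _ = 4 * B * ‖u‖ * (σ - σ') := by ring
      _ ≤ _ := by gcongr; exact le_add_of_nonneg_right (by positivity)
  · rcases hσ'.eq_or_lt with rfl | hσ'0
    · obtain rfl : σ = 0 := by linarith
      simp
    have hσ : 0 < σ := hσ'0.trans_le hle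
    have hlog : 0 ≤ Real.log σ - Real.log σ' := sub_nonneg.2 (Real.log_le_log hσ'0 hle)
    have hmδ : B * σ * ‖u‖ ≤ δ := by
      refine le_trans ?_ huδ
      gcongr
      exact mul_le_of_le_one_right (by positivity) hσ1
    rw [h.logFlow_eq_conjExp a hσ'0 hσ] at hσn' ⊢
    calc _ ≤ (C + 2 / δ) * ‖(Real.log σ - Real.log σ') • a‖ * (B * σ * ‖u‖) :=
          h.dist_conjExp_le hG hσn hσn' hmδ
      _ = (C + 2 / δ) * ((Real.log σ - Real.log σ') * ‖a‖) * (B * σ * ‖u‖) := by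
          rw [norm_smul, Real.norm_of_nonneg hlog]
      _ ≤ (C + 2 / δ) * ((2 / σ * (σ - σ')) * ‖a‖) * (B * σ * ‖u‖) := by
          gcongr
          exact log_sub_log_le_of_half_le hσ hle hhalf
      _ = 2 * B * (C + 2 / δ) * ‖a‖ * ‖u‖ * (σ - σ') := by field_simp
      _ ≤ _ := by gcongr; exact le_add_of_nonneg_left (by positivity)

end LogFlow

section LipschitzCone

/-- `F r z` is a Lipschitz function of the point with polar coordinates `r ∈ [0, 1]` and `z` of the
cone over `Z`: it is Lipschitz along the rays, and at radius `r` it is Lipschitz in `z` with a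
constant proportional to `r`. -/
structure IsLipschitzCone {Z X : Type*} [PseudoMetricSpace Z] [PseudoMetricSpace X] (B : ℝ)
    (F : ℝ → Z → X) : Prop where
  radial : ∀ z r r', 0 ≤ r' → r' ≤ r → r ≤ 1 → dist (F r z) (F r' z) ≤ B * (r - r')
  angular : ∀ r z z', 0 ≤ r → r ≤ 1 → dist (F r z) (F r z') ≤ B * r * dist z z'

namespace IsLipschitzCone

theorem glue {Z X : Type*} [PseudoMetricSpace Z] [PseudoMetricSpace X] {B B' : ℝ}
    {F H : ℝ → Z → X} (hF : IsLipschitzCone B F) (hB : 0 ≤ B) (hB' : 0 ≤ B')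
    (hH_radial : ∀ z s s', s' ≤ s → dist (H s z) (H s' z) ≤ B' * (s - s'))
    (hH_angular : ∀ s z z', s ≤ 1 → dist (H s z) (H s z') ≤ B' * dist z z')
    (hFH : ∀ z, F 1 z = H 0 z) :
    IsLipschitzCone (2 * (B + B'))
      fun r z ↦ if r ≤ 1 / 2 then F (2 * r) z else H (2 * r - 1) z := by
  have hF_radial : ∀ z r r', 0 ≤ r' → r' ≤ r → r ≤ 1 / 2 →
      dist (F (2 * r) z) (F (2 * r') z) ≤ 2 * B * (r - r') := fun z r r' hr' hle hr ↦
    (hF.radial z (2 * r) (2 * r') (by linarith) (by linarith) (by linarith)).trans_eq (by ring)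
  have hH_radial' : ∀ z r r', r' ≤ r →
      dist (H (2 * r - 1) z) (H (2 * r' - 1) z) ≤ 2 * B' * (r - r') := fun z r r' hle ↦
    (hH_radial z _ _ (by linarith)).trans_eq (by ring)
  refine ⟨fun z r r' hr' hle _ ↦ ?_, fun r z z' hr hr1 ↦ ?_⟩
  · have hBr : 0 ≤ B * (r - r') := mul_nonneg hB (sub_nonneg.2 hle)
    have hBr' : 0 ≤ B' * (r - r') := mul_nonneg hB' (sub_nonneg.2 hle)
    split_ifs with hr_half hr_half' hr_half'
    · linarith [hF_radial z r r' hr' hle hr_half]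
    · linarith
    · have hinner := hF_radial z (1 / 2) r' hr' hr_half' le_rfl
      have houter := hH_radial' z r (1 / 2) (by linarith)
      rw [mul_one_div_cancel two_ne_zero, hFH] at hinner
      rw [mul_one_div_cancel two_ne_zero, sub_self] at houter
      have htri := dist_triangle (H (2 * r - 1) z) (H 0 z) (F (2 * r') z)
      have hBle : B * (1 / 2 - r') ≤ B * (r - r') := by gcongr; linarith
      have hBle' : B' * (r - 1 / 2) ≤ B' * (r - r') := by gcongr
      linarith
    · linarith [hH_radial' z r r' hle]
  · have hBd : 0 ≤ B * r * dist z z' := by positivity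
    have hBd' : 0 ≤ B' * r * dist z z' := by positivity
    split_ifs with hr_half
    · linarith [hF.angular (2 * r) z z' (by linarith) (by linarith)]
    · have hr_le : B' * dist z z' * 1 ≤ B' * dist z z' * (2 * r) := by gcongr; linarith
      linarith [hH_angular (2 * r - 1) z z' (by linarith)]

theorem smul {Z V : Type*} [PseudoMetricSpace Z] [SeminormedAddCommGroup V] [NormedSpace ℝ V]
    {B : ℝ} {α : Z → V} (hα : ∀ z, ‖α z‖ ≤ B) (hα_lip : ∀ z z', ‖α z - α z'‖ ≤ B * dist z z') :
    IsLipschitzCone B fun r z ↦ r • α z := by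
  refine ⟨fun z r r' _ hle _ ↦ ?_, fun r z z' hr _ ↦ ?_⟩
  · rw [dist_eq_norm, ← sub_smul, norm_smul, Real.norm_of_nonneg (sub_nonneg.2 hle), mul_comm]
    exact mul_le_mul_of_nonneg_right (hα z) (sub_nonneg.2 hle)
  · rw [dist_eq_norm, ← smul_sub, norm_smul, Real.norm_of_nonneg hr, mul_comm B, mul_assoc]
    exact mul_le_mul_of_nonneg_left (hα_lip z z') hr

theorem mul_left {Z G : Type*} [PseudoMetricSpace Z] [SeminormedGroup G] {B : ℝ} {F : ℝ → Z → G}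
    (hF : IsLipschitzCone B F) (g : G) : IsLipschitzCone B fun r z ↦ g * F r z := by
  refine ⟨?_, ?_⟩ <;> simp only [dist_mul_left]
  exacts [hF.radial, hF.angular]

theorem exp_mul {Z G V : Type*} [PseudoMetricSpace Z] [SeminormedGroup G]
    [SeminormedAddCommGroup V] {e : V → G} {ℓ : G → V} {L C δ : ℝ} (h : IsMetricSplitting e ℓ L)
    (hG : IsGleasonMetric G C δ) (hl : IsLengthGroup G) {B B' : ℝ} {X : ℝ → Z → V}
    {W : ℝ → Z → G} (hX : IsLipschitzCone B X) (hW : IsLipschitzCone B' W)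
    (hWδ : ∀ r z, 0 ≤ r → r ≤ 1 → ‖W r z‖ ≤ δ) :
    IsLipschitzCone ((1 + C * δ) * B + B') fun r z ↦ e (X r z) * W r z := by
  have hP : 0 ≤ 1 + C * δ := by
    have := mul_nonneg (zero_le_one.trans hG.one_le) hG.pos.le
    positivity
  have hdist : ∀ x y w w', ‖w'‖ ≤ δ →
      dist (e x * w) (e y * w') ≤ (1 + C * δ) * dist x y + dist w w' := by
    intro x y w w' hw'
    have htri := dist_triangle (e x * w) (e x * w') (e y * w')
    rw [dist_mul_left] at htri
    rw [add_comm, dist_eq_norm x y]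
    exact htri.trans (by gcongr; exact h.dist_exp_mul_le hG hl hw' x y)
  refine ⟨fun z r r' hr' hle hr ↦ ?_, fun r z z' hr hr1 ↦ ?_⟩
  · refine (hdist _ _ _ _ (hWδ r' z hr' (hle.trans hr))).trans ?_
    linarith [mul_le_mul_of_nonneg_left (hX.radial z r r' hr' hle hr) hP,
      hW.radial z r r' hr' hle hr]
  · refine (hdist _ _ _ _ (hWδ r z' hr hr1)).trans ?_
    linarith [mul_le_mul_of_nonneg_left (hX.angular r z z' hr hr1) hP,
      hW.angular r z z' hr hr1]

end IsLipschitzCone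

end LipschitzCone

section DiskFilling

/-- The direction of a point of the disk, with an arbitrary choice at the origin. -/
noncomputable def diskDirection (w : ℂ) : Metric.sphere (0 : ℂ) 1 :=
  if h : w = 0 then 1 else ⟨w / ‖w‖, by simp [h]⟩

theorem norm_mul_coe_diskDirection (w : ℂ) : (‖w‖ : ℂ) * diskDirection w = w := by
  unfold diskDirection
  split_ifs with h
  · simp [h]
  · exact mul_div_cancel₀ w (by simpa using h)

theorem diskDirection_coe (z : Metric.sphere (0 : ℂ) 1) : diskDirection z = z := by
  have h := norm_mul_coe_diskDirection (z : ℂ)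
  rw [norm_eq_of_mem_sphere, Complex.ofReal_one, one_mul] at h
  exact Subtype.ext h

theorem norm_mul_dist_diskDirection_le {w w' : ℂ} (hle : ‖w'‖ ≤ ‖w‖) :
    ‖w'‖ * dist (diskDirection w) (diskDirection w') ≤ 2 * ‖w - w'‖ := by
  have hprod : ‖w'‖ * dist (diskDirection w) (diskDirection w') =
      ‖(‖w'‖ : ℂ) * diskDirection w - w'‖ := by
    nth_rewrite 4 [← norm_mul_coe_diskDirection w']
    rw [← mul_sub, Subtype.dist_eq, dist_eq_norm, norm_mul, Complex.norm_real, norm_norm]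
  have hradial : ‖(‖w'‖ : ℂ) * diskDirection w - w‖ = ‖w‖ - ‖w'‖ := by
    nth_rewrite 2 [← norm_mul_coe_diskDirection w]
    rw [← sub_mul, ← Complex.ofReal_sub, norm_mul, norm_eq_of_mem_sphere, mul_one,
      Complex.norm_real, Real.norm_of_nonpos (sub_nonpos.2 hle), neg_sub]
  rw [hprod]
  linarith [norm_sub_le_norm_sub_add_norm_sub ((‖w'‖ : ℂ) * diskDirection w) w w',
    norm_sub_norm_le w w']

theorem IsLipschitzCone.lipschitzWith_diskDirection {X : Type*} [PseudoMetricSpace X]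
    {F : ℝ → Metric.sphere (0 : ℂ) 1 → X} {B : ℝ≥0} (hF : IsLipschitzCone B F) :
    LipschitzWith (3 * B)
      (fun w : Metric.closedBall (0 : ℂ) 1 ↦ F ‖(w : ℂ)‖ (diskDirection w)) := by
  have hdist : ∀ w w' : Metric.closedBall (0 : ℂ) 1, ‖(w' : ℂ)‖ ≤ ‖(w : ℂ)‖ →
      dist (F ‖(w : ℂ)‖ (diskDirection w)) (F ‖(w' : ℂ)‖ (diskDirection w')) ≤
        3 * B * dist w w' := by
    intro w w' hle
    have hw1 : ‖(w : ℂ)‖ ≤ 1 := mem_closedBall_zero_iff.1 w.2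
    have hradial := hF.radial (diskDirection w) _ _ (norm_nonneg _) hle hw1
    have hangular := hF.angular _ (diskDirection w) (diskDirection w') (norm_nonneg _)
      (hle.trans hw1)
    calc _ ≤ _ := dist_triangle _ (F ‖(w' : ℂ)‖ (diskDirection w)) _
      _ ≤ B * (‖(w : ℂ)‖ - ‖(w' : ℂ)‖) +
          B * (‖(w' : ℂ)‖ * dist (diskDirection w) (diskDirection w')) := by
        rw [← mul_assoc]
        exact add_le_add hradial hangular
      _ ≤ B * ‖(w : ℂ) - w'‖ + B * (2 * ‖(w : ℂ) - w'‖) := by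
        exact add_le_add (mul_le_mul_of_nonneg_left (norm_sub_norm_le _ _) B.2)
          (mul_le_mul_of_nonneg_left (norm_mul_dist_diskDirection_le hle) B.2)
      _ = 3 * B * dist w w' := by rw [Subtype.dist_eq, dist_eq_norm]; ring
  refine LipschitzWith.of_dist_le_mul fun w w' ↦ ?_
  push_cast
  rcases le_total ‖(w' : ℂ)‖ ‖(w : ℂ)‖ with hle | hle
  · exact hdist w w' hle
  · rw [dist_comm, dist_comm w]
    exact hdist w' w hle

theorem lipschitzOneConnected_of_forall_exists_isFilling {X : Type*} [PseudoEMetricSpace X]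
    {C : ℝ≥0} (h : ∀ (K : ℝ≥0) (γ : Metric.sphere (0 : ℂ) 1 → X), LipschitzWith K γ →
      ∃ f : Metric.closedBall (0 : ℂ) 1 → X, IsFilling γ f ∧ LipschitzWith (C * K) f) :
    LipschitzOneConnected X := by
  -- A nonzero constant, so that it can be moved inside the infimum.
  refine ⟨C + 1, fun γ _ ↦ ?_⟩
  rw [lipConst, ENNReal.mul_iInf_of_ne (by simp) (by simp)]
  refine le_iInf fun K ↦ ?_
  rw [ENNReal.mul_iInf_of_ne (by simp) (by simp)]
  refine le_iInf fun hK ↦ ?_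
  obtain ⟨f, hf, hf_lip⟩ := h K γ hK
  calc fillingSpan γ ≤ lipConst f := iInf₂_le f hf
    _ ≤ ((C * K : ℝ≥0) : ℝ≥0∞) := iInf₂_le (C * K) hf_lip
    _ ≤ ((C + 1 : ℝ≥0) : ℝ≥0∞) * K := by
      rw [ENNReal.coe_mul]
      gcongr
      exact le_self_add

theorem lipschitzOneConnected_of_forall_exists_isLipschitzCone {G : Type*} [SeminormedGroup G]
    {M : ℝ} (hM : 0 ≤ M)
    (h : ∀ (K : ℝ≥0) (β : Metric.sphere (0 : ℂ) 1 → G), LipschitzWith K β → β 1 = 1 →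
      ∃ F, IsLipschitzCone (M * K) F ∧ ∀ z, F 1 z = β z) :
    LipschitzOneConnected G := by
  lift M to ℝ≥0 using hM
  refine lipschitzOneConnected_of_forall_exists_isFilling (C := 3 * M) fun K γ hγ ↦ ?_
  have hβ : LipschitzWith K fun z ↦ (γ 1)⁻¹ * γ z :=
    LipschitzWith.of_dist_le_mul fun z z' ↦ (dist_mul_left _ _ _).trans_le (hγ.dist_le_mul z z')
  obtain ⟨F, hF, hFβ⟩ := h K _ hβ (inv_mul_cancel _)
  refine ⟨fun w ↦ γ 1 * F ‖(w : ℂ)‖ (diskDirection w), fun z ↦ ?_, ?_⟩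
  · simp only [norm_eq_of_mem_sphere, diskDirection_coe, hFβ, mul_inv_cancel_left]
  · rw [mul_assoc]
    exact (hF.mul_left (γ 1)).lipschitzWith_diskDirection (B := M * K)

end DiskFilling

section Filling

theorem dist_mul_exp_right {G V : Type*} [SeminormedGroup G] (e : V → G) (x y : G) (v : V) :
    dist (x * e v) (y * e v) = ‖conjExp e v (x⁻¹ * y)‖ := by
  rw [dist_eq_norm_inv_mul, conjExp_apply]
  group

variable {G V : Type*} [SeminormedGroup G] [SeminormedAddCommGroup V] {e : V → G} {ℓ : G → V}
  {L C δ : ℝ}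

theorem IsMetricSplitting.norm_log_sub_le (h : IsMetricSplitting e ℓ L) (x y : G) :
    ‖ℓ x - ℓ y‖ ≤ L * dist x y := by
  have hlog := h.norm_log_le (y⁻¹ * x)
  rwa [h.log_mul, h.log_inv, neg_add_eq_sub, ← dist_eq_norm_inv_mul, dist_comm] at hlog

theorem IsMetricSplitting.dist_exp_le (h : IsMetricSplitting e ℓ L) (v w : V) :
    dist (e v) (e w) ≤ ‖v - w‖ := by
  rw [dist_eq_norm_inv_mul, ← h.map_neg, ← h.map_add, neg_add_eq_sub, norm_sub_rev]
  exact h.norm_le _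

theorem IsMetricSplitting.exp_mul_exp_log_mul_conjExp_kerPart (h : IsMetricSplitting e ℓ L) (x : G)
    (v : V) : e v * (e (ℓ x) * conjExp e v (kerPart e ℓ x)) = x * e v := by
  rw [← mul_assoc, ← h.map_add, add_comm, h.map_add, conjExp_apply, kerPart]
  group

theorem IsMetricSplitting.dist_conjExp_kerPart_le (h : IsMetricSplitting e ℓ L)
    (hG : IsGleasonMetric G C δ) (hl : IsLengthGroup G) {v : V} {R : ℝ}
    (hR : ∀ g, ‖conjExp e v g‖ ≤ R * ‖g‖) {x y : G} (hy : ‖conjExp e v (kerPart e ℓ y)‖ ≤ δ) :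
    dist (conjExp e v (kerPart e ℓ x)) (conjExp e v (kerPart e ℓ y)) ≤
      (R + (1 + C * δ) * L) * dist x y := by
  have hP : 0 ≤ 1 + C * δ := by
    have := mul_nonneg (zero_le_one.trans hG.one_le) hG.pos.le
    positivity
  have htranslate : dist (e (ℓ x) * conjExp e v (kerPart e ℓ x))
      (e (ℓ y) * conjExp e v (kerPart e ℓ y)) ≤ R * dist x y := by
    rw [← dist_mul_left (e v), h.exp_mul_exp_log_mul_conjExp_kerPart,
      h.exp_mul_exp_log_mul_conjExp_kerPart, dist_mul_exp_right, dist_eq_norm_inv_mul]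
    exact hR _
  have hlog : dist (e (ℓ y) * conjExp e v (kerPart e ℓ y))
      (e (ℓ x) * conjExp e v (kerPart e ℓ y)) ≤ (1 + C * δ) * (L * dist x y) := by
    rw [dist_comm]
    exact (h.dist_exp_mul_le hG hl hy _ _).trans
      (mul_le_mul_of_nonneg_left (h.norm_log_sub_le x y) hP)
  rw [← dist_mul_left (e (ℓ x)), add_mul, mul_assoc]
  exact (dist_triangle _ _ _).trans (add_le_add htranslate hlog)

variable [NormedSpace ℝ V] {a : V} {B η θ : ℝ} {Z : Type*} [PseudoMetricSpace Z]

theorem IsContractingFlow.exists_isLipschitzCone_logFlow (hf : IsContractingFlow e ℓ a B η)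
    (h : IsMetricSplitting e ℓ L) (hG : IsGleasonMetric G C δ) (hθη : 2 * θ ≤ η)
    (hθδ : B * θ ≤ δ) :
    ∃ D : ℝ, 0 ≤ D ∧ ∀ (N : ℝ) (v : Z → G), (∀ z, ℓ (v z) = 0) → (∀ z, ‖v z‖ ≤ θ) →
      (∀ z, ‖v z‖ ≤ N) → (∀ z z', dist (v z) (v z') ≤ N * dist z z') →
      IsLipschitzCone (D * N) fun r z ↦ logFlow e a r (v z) := by
  have hB := hf.one_le
  obtain ⟨D, hD, hradial⟩ := hf.exists_dist_logFlow_le h hG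
  refine ⟨B + D, by positivity, fun N v hvℓ hvθ hvN hv_lip ↦ ⟨fun z r r' hr' hle hr ↦ ?_,
    fun r z z' hr hr1 ↦ ?_⟩⟩
  · have : 0 ≤ N := (norm_nonneg' _).trans (hvN z)
    have hvη : ‖v z‖ ≤ η := by linarith [hvθ z, norm_nonneg' (v z)]
    calc _ ≤ D * ‖v z‖ * (r - r') := hradial _ (hvℓ z) hvη
          ((mul_le_mul_of_nonneg_left (hvθ z) (zero_le_one.trans hB)).trans hθδ) r r' hr' hle hr
      _ ≤ (B + D) * N * (r - r') := by
        gcongr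
        · linarith
        · exact hvN z
  · have : 0 ≤ N := (norm_nonneg' _).trans (hvN z)
    have hdist : ‖(v z)⁻¹ * v z'‖ ≤ η := by
      rw [← dist_eq_norm_inv_mul]
      linarith [dist_le_norm_add_norm' (v z) (v z'), hvθ z, hvθ z']
    have hlog : ℓ ((v z)⁻¹ * v z') = 0 := by
      rw [h.log_mul, h.log_inv, hvℓ, hvℓ, neg_zero, add_zero]
    have hflow := hf.norm_logFlow_le hlog hdist hr hr1
    rw [map_mul, map_inv, ← dist_eq_norm_inv_mul, ← dist_eq_norm_inv_mul] at hflow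
    calc _ ≤ B * r * dist (v z) (v z') := hflow
      _ ≤ B * r * (N * dist z z') := by gcongr; exact hv_lip z z'
      _ = B * N * r * dist z z' := by ring
      _ ≤ (B + D) * N * r * dist z z' := by gcongr; linarith

theorem IsContractingFlow.exists_isLipschitzCone_exp_mul (hf : IsContractingFlow e ℓ a B η)
    (h : IsMetricSplitting e ℓ L) (hG : IsGleasonMetric G C δ) (hl : IsLengthGroup G) :
    ∃ θ : ℝ, 0 < θ ∧ θ ≤ δ ∧ ∃ M : ℝ, 0 ≤ M ∧ ∀ (N : ℝ) (α : Z → V) (v : Z → G),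
      (∀ z, ‖α z‖ ≤ N) → (∀ z z', ‖α z - α z'‖ ≤ N * dist z z') →
      (∀ z, ℓ (v z) = 0) → (∀ z, ‖v z‖ ≤ θ) → (∀ z, ‖v z‖ ≤ N) →
      (∀ z z', dist (v z) (v z') ≤ N * dist z z') →
      ∃ F, IsLipschitzCone (M * N) F ∧ ∀ z, F 1 z = e (α z) * v z := by
  have hC := hG.one_le
  have hδ := hG.pos
  have hB := hf.one_le
  have hη := hf.pos
  have hθη : 2 * min (η / 2) (δ / B) ≤ η := by linarith [min_le_left (η / 2) (δ / B)]
  have hθδ : B * min (η / 2) (δ / B) ≤ δ :=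
    (le_div_iff₀' (by positivity)).1 (min_le_right (η / 2) (δ / B))
  have hθ : 0 < min (η / 2) (δ / B) := by positivity
  generalize min (η / 2) (δ / B) = θ at hθη hθδ hθ
  obtain ⟨D, hD, hcone⟩ := hf.exists_isLipschitzCone_logFlow (Z := Z) h hG hθη hθδ
  refine ⟨θ, hθ, (le_mul_of_one_le_left hθ.le hB).trans hθδ, 1 + C * δ + D, by positivity,
    fun N α v hα hα_lip hvℓ hvθ hvN hv_lip ↦
      ⟨fun r z ↦ e (r • α z) * logFlow e a r (v z), ?_, fun z ↦ ?_⟩⟩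
  · rw [add_mul]
    refine (IsLipschitzCone.smul hα hα_lip).exp_mul h hG hl (hcone N v hvℓ hvθ hvN hv_lip)
      fun r z hr hr1 ↦ ?_
    calc _ ≤ B * r * ‖v z‖ := hf.norm_logFlow_le (hvℓ z) (by linarith [hvθ z]) hr hr1
      _ ≤ B * 1 * θ := by gcongr; exact hvθ z
      _ ≤ δ := by rwa [mul_one]
  · simp only [one_smul, h.logFlow_one]

theorem IsLipschitzCone.exists_of_mul_exp {F : ℝ → Z → G} {β : Z → G} {B B' R S : ℝ}
    (hF : IsLipschitzCone B F) (h : IsMetricSplitting e ℓ L) (hB : 0 ≤ B) (hB' : 0 ≤ B')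
    (hS : 0 ≤ S) (hR : ∀ s : ℝ, 0 ≤ s → ∀ g, ‖conjExp e (s • a) g‖ ≤ R * ‖g‖)
    (hβ : ∀ z z', R * dist (β z) (β z') ≤ B' * dist z z') (hFβ : ∀ z, F 1 z = β z * e (S • a)) :
    ∃ F', IsLipschitzCone (2 * (B + (B' + S * ‖a‖))) F' ∧ ∀ z, F' 1 z = β z := by
  refine ⟨_, hF.glue (H := fun s z ↦ β z * e (((1 - s) * S) • a)) hB (by positivity)
    (fun z s s' hle ↦ ?_) (fun s z z' hs ↦ ?_) (fun z ↦ by simp [hFβ]), fun z ↦ ?_⟩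
  · have := sub_nonneg.2 hle
    rw [dist_mul_left]
    calc _ ≤ ‖((1 - s) * S) • a - ((1 - s') * S) • a‖ := h.dist_exp_le _ _
      _ = S * ‖a‖ * (s - s') := by
        rw [norm_sub_rev, ← sub_smul, norm_smul, ← sub_mul, sub_sub_sub_cancel_left,
          Real.norm_of_nonneg (by positivity)]
        ring
      _ ≤ (B' + S * ‖a‖) * (s - s') := by gcongr; exact le_add_of_nonneg_left hB'
  · have hconj := hR ((1 - s) * S) (mul_nonneg (sub_nonneg.2 hs) hS) ((β z)⁻¹ * β z')
    rw [← dist_mul_exp_right, ← dist_eq_norm_inv_mul] at hconj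
    refine (hconj.trans (hβ z z')).trans ?_
    gcongr
    exact le_add_of_nonneg_right (by positivity)
  · norm_num [h.map_zero]

theorem IsContractingFlow.exists_isLipschitzCone (hf : IsContractingFlow e ℓ a B η)
    (h : IsMetricSplitting e ℓ L) (hG : IsGleasonMetric G C δ) (hl : IsLengthGroup G) :
    ∃ M : ℝ, 0 ≤ M ∧ ∀ (N : ℝ) (β : Z → G), 0 ≤ N → (∀ z, ‖β z‖ ≤ N) →
      (∀ z z', dist (β z) (β z') ≤ N * dist z z') →
      ∃ F, IsLipschitzCone (M * N) F ∧ ∀ z, F 1 z = β z := by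
  have hC := hG.one_le
  have hδ := hG.pos
  have hL := h.one_le
  obtain ⟨R, hR, hR_le⟩ := hf.exists_norm_conjExp_le_mul_norm h hl
  obtain ⟨θ, hθ, hθδ, M, hM, hcone⟩ := hf.exists_isLipschitzCone_exp_mul (Z := Z) h hG hl
  obtain ⟨S₀, hS₀, hsmall⟩ := hf.exists_norm_conjExp_le h hG hl hθ
  set Q := R + (1 + C * δ) * L
  have hLQ : L ≤ Q := by nlinarith [mul_nonneg (zero_le_one.trans hC) hδ.le]
  refine ⟨2 * (M * Q + (R + S₀ * (L + 1) * ‖a‖)), by positivity, fun N β hN hβ hβ_lip ↦ ?_⟩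
  set S := S₀ * ((L + 1) * N)
  have hS : 0 ≤ S := by positivity
  set v : Z → G := fun z ↦ conjExp e (S • a) (kerPart e ℓ (β z))
  have hvθ : ∀ z, ‖v z‖ ≤ θ := fun z ↦ hsmall _ (h.log_kerPart _) S <|
    mul_le_mul_of_nonneg_left ((h.norm_kerPart_le _).trans (by gcongr; exact hβ z)) hS₀.le
  have hv_dist : ∀ z x, dist (conjExp e (S • a) (kerPart e ℓ x)) (v z) ≤ Q * dist x (β z) :=
    fun z x ↦ h.dist_conjExp_kerPart_le hG hl (hR_le S hS) ((hvθ z).trans hθδ)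
  have hv_lip : ∀ z z', dist (v z) (v z') ≤ Q * N * dist z z' := fun z z' ↦ by
    rw [mul_assoc]
    exact (hv_dist z' (β z)).trans (by gcongr; exact hβ_lip z z')
  have hv_norm : ∀ z, ‖v z‖ ≤ Q * N := fun z ↦ by
    have hdist := hv_dist z 1
    rw [h.kerPart_of_log_eq_zero h.log_one, map_one, dist_one_left, dist_one_left] at hdist
    exact hdist.trans (by gcongr; exact hβ z)
  obtain ⟨F, hF, hF_one⟩ := hcone (Q * N) (fun z ↦ ℓ (β z)) v
    (fun z ↦ (h.norm_log_le _).trans (by gcongr; exact hβ z))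
    (fun z z' ↦ (h.norm_log_sub_le _ _).trans (by rw [mul_assoc]; gcongr; exact hβ_lip z z'))
    (fun z ↦ (h.log_conjExp _ _).trans (h.log_kerPart _)) hvθ hv_norm hv_lip
  have hF_mul : ∀ z, e (S • a) * F 1 z = β z * e (S • a) := fun z ↦ by
    rw [hF_one, h.exp_mul_exp_log_mul_conjExp_kerPart]
  obtain ⟨F', hF', hF'_one⟩ := (hF.mul_left (e (S • a))).exists_of_mul_exp (β := β) (B' := R * N) h
    (by positivity) (by positivity) hS hR_le
    (fun z z' ↦ by rw [mul_assoc]; gcongr; exact hβ_lip z z') hF_mul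
  refine ⟨F', ?_, hF'_one⟩
  convert hF' using 1
  ring

theorem IsContractingFlow.lipschitzOneConnected (hf : IsContractingFlow e ℓ a B η)
    (h : IsMetricSplitting e ℓ L) (hG : IsGleasonMetric G C δ) (hl : IsLengthGroup G) :
    LipschitzOneConnected G := by
  obtain ⟨M, hM, hcone⟩ := hf.exists_isLipschitzCone (Z := Metric.sphere (0 : ℂ) 1) h hG hl
  refine lipschitzOneConnected_of_forall_exists_isLipschitzCone (M := M * 2) (by positivity)
    fun K β hβ hβ_one ↦ ?_
  have hβ_norm : ∀ z, ‖β z‖ ≤ 2 * K := fun z ↦ by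
    have hz : dist (1 : Metric.sphere (0 : ℂ) 1) z ≤ 2 := by
      have := dist_le_norm_add_norm (1 : ℂ) (z : ℂ)
      rw [norm_one, norm_eq_of_mem_sphere] at this
      exact this.trans_eq one_add_one_eq_two
    have hdist := hβ.dist_le_mul 1 z
    rw [hβ_one, dist_one_left] at hdist
    exact hdist.trans (by rw [mul_comm]; gcongr)
  rw [mul_assoc]
  refine hcone (2 * K) β (by positivity) hβ_norm fun z z' ↦ (hβ.dist_le_mul z z').trans ?_
  gcongr
  exact le_mul_of_one_le_left K.2 one_le_two

end Filling

theorem IsUnipotentByAbelian.lipschitzOneConnected {G : Type*} [NormedGroup G]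
    [IsTopologicalGroup G] [LocallyCompactSpace G] (hl : IsLengthGroup G) {C δ : ℝ}
    (hG : IsGleasonMetric G C δ) {U A : Subgroup G} (hUA : IsUnipotentByAbelian U A)
    (htame : IsTame U A) : LipschitzOneConnected G := by
  have : ProperSpace G := hl.properSpace
  have : ProperSpace A := ProperSpace.of_isClosed hUA.isClosed_right
  have : ContractibleSpace A := hUA.contractible_right
  let _ : NormedCommGroup A :=
    { (inferInstance : NormedGroup A) with mul_comm := hUA.comm.is_comm.comm }
  obtain ⟨pr, hpr, hprA, hker⟩ := exists_continuous_projection hUA.isClosed_left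
    hUA.isClosed_right hUA.normal hUA.isComplement
  obtain ⟨e, ℓ, L, hsplit, hℓ, he⟩ := exists_isMetricSplitting (ι := A.subtype) hl
    (hG.subgroup A) hpr (fun _ ↦ le_rfl) hprA
  obtain ⟨a, haA, Ω, hΩ⟩ := htame
  obtain ⟨n, -, hhalf⟩ := hΩ.exists_norm_conj_le_half hG hUA.isClosed_left hUA.unipotent
  have hea : e (n • ℓ a) = a ^ n := by rw [hsplit.exp_nsmul, show e (ℓ a) = a from he ⟨a, haA⟩]
  obtain ⟨b, B, η, hflow⟩ := hsplit.exists_isContractingFlow hG (b := n • ℓ a) fun u hu huδ ↦ by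
    rw [conjExp_apply, hea]
    exact hhalf u (by rwa [← hker, MonoidHom.mem_ker, ← hℓ]) huδ
  exact hflow.lipschitzOneConnected hsplit hG hl

theorem isContinuousRiemannianBundle_of_isContMDiffRiemannianBundle
    {EB : Type*} [NormedAddCommGroup EB] [NormedSpace ℝ EB] {HB : Type*} [TopologicalSpace HB]
    (IB : ModelWithCorners ℝ EB HB) (n : ℕ∞ω) {B : Type*} [TopologicalSpace B] [ChartedSpace HB B]
    (F : Type*) [NormedAddCommGroup F] [NormedSpace ℝ F] (E : B → Type*)
    [TopologicalSpace (Bundle.TotalSpace F E)] [∀ x, NormedAddCommGroup (E x)]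
    [∀ x, InnerProductSpace ℝ (E x)] [FiberBundle F E] [VectorBundle ℝ F E]
    [IsContMDiffRiemannianBundle IB n F E] : IsContinuousRiemannianBundle F E := by
  obtain ⟨g, hg, hg'⟩ := IsContMDiffRiemannianBundle.exists_contMDiff (IB := IB) (n := n)
    (F := F) (E := E)
  exact ⟨g, hg.continuous, hg'⟩

theorem proposition4p3
    {E : Type*} [NormedAddCommGroup E] [NormedSpace ℝ E] [FiniteDimensional ℝ E]
    {G : Type*} [Group G] [MetricSpace G] [ChartedSpace E G] [LieGroup 𝓘(ℝ, E) ∞ G]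
    [Bundle.RiemannianBundle (fun x : G ↦ TangentSpace 𝓘(ℝ, E) x)]
    [IsContMDiffRiemannianBundle 𝓘(ℝ, E) ∞ E (fun x : G ↦ TangentSpace 𝓘(ℝ, E) x)]
    [IsRiemannianManifold 𝓘(ℝ, E) G]
    (hG : IsLeftInvariantMetric E G)
    (U A : Subgroup G) (hUA : IsUnipotentByAbelian U A) (htame : IsTame U A) :
    LipschitzOneConnected G := by
  have : IsIsometricSMul G G := isIsometricSMul_of_isLeftInvariantMetric hG
  let _ : Norm G := ⟨dist 1⟩
  let _ : NormedGroup G := .ofMulDist (fun _ ↦ rfl) fun x y z ↦ (dist_mul_left z x y).ge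
  have : IsContinuousRiemannianBundle E (fun x : G ↦ TangentSpace 𝓘(ℝ, E) x) :=
    isContinuousRiemannianBundle_of_isContMDiffRiemannianBundle 𝓘(ℝ, E) ∞ E _
  have : IsTopologicalGroup G := topologicalGroup_of_lieGroup 𝓘(ℝ, E) ∞
  have : LocallyCompactSpace G := Manifold.locallyCompact_of_finiteDimensional 𝓘(ℝ, E)
  obtain ⟨C, δ, hGleason⟩ := exists_isGleasonMetric_of_isRiemannianManifold (E := E) (G := G)
  exact hUA.lipschitzOneConnected (isLengthGroup_of_isRiemannianManifold (E := E)) hGleason htame
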